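/- Let $d\in\mathbb N$ and $T>0$. Let $\Gamma$ be the set of curves $\gamma\in L^2((-1,T),\mathbb R^d)$ that are affine on $(-1,0)$, with the $L^2$ metric, and for $\gamma\in\Gamma$ let $\gamma(0),\gamma(-1)$ be the values at $0,-1$ of the affine function that equals $\gamma$ on $(-1,0)$; put $W_0(\gamma)=\gamma(0)-\gamma(-1)$. Let $\mathcal P(\Gamma)$ be the set of Borel probability measures on $\Gamma$ with the narrow topology, and $$\mathcal M(\Gamma)=\Big\{\eta\in\mathcal P(\Gamma):\ \int|\gamma(0)|^2\,\eta(d\gamma)\le 1,\ \int\|\dot\gamma\|_{L^2(-1,T)}^2\,\eta(d\gamma)\le 1\Big\},$$ where $\dot\gamma$ is the weak derivative and $\|\dot\gamma\|_{L^2(-1,T)}=\infty$ if $\gamma\notin W^{1,2}((-1,T),\mathbb R^d)$; for $\gamma\in W^{1,2}$, $\dot\gamma(t)$ denotes the pointwise derivative at $t$ of the continuous representative of $\gamma$, which exists for a.e. $t$. For $t\in[0,T]$ let $T_t:\Gamma\to\Gamma_t:=L^2((t,T),\mathbb R^d)$, $T_t(\gamma)=\gamma|_{(t,T)}$, let $\{\omega^t_{\gamma'}\}_{\gamma'\in\Gamma_t}$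 be the disintegration of $\eta$ along $T_t$ (that is, the regular conditional probability on $\Gamma$ given $T_t$), and put $$V_t(\gamma)=\int W_0(\gamma')\,\omega^t_{T_t(\gamma)}(d\gamma').$$ A measure $\eta\in\mathcal M(\Gamma)$ is called a dissipative solution (of the pressureless Euler system) if $\dot\gamma(t)=V_t(\gamma)$ for $\mathcal L^1\times\eta$-a.e. $(t,\gamma)\in[0,T]\times\Gamma$, where $(t,\gamma)\mapsto V_t(\gamma)$ is taken in a jointly measurable version. Then the set of dissipative solutions is a compact subset of $\mathcal P(\Gamma)$ in the narrow topology. -/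

import Mathlib

open MeasureTheory ProbabilityTheory Set
open scoped ENNReal ContDiff

noncomputable section

namespace PressurelessEuler

/-- The state space `ℝ^d` with the Euclidean norm. -/
abbrev Vec (d : ℕ) : Type := EuclideanSpace ℝ (Fin d)

/-- `L²` spaces of `ℝ^d`-valued functions carry their Borel `σ`-algebra. -/
instance instMeasurableSpaceL2 (d : ℕ) (μ : Measure ℝ) : MeasurableSpace (Lp (Vec d) 2 μ) :=
  borel _

instance instBorelSpaceL2 (d : ℕ) (μ : Measure ℝ) : BorelSpace (Lp (Vec d) 2 μ) := ⟨rfl⟩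

/-- Lebesgue measure on the time interval `(-1, T)`. -/
abbrev timeMeasure (T : ℝ) : Measure ℝ := volume.restrict (Ioo (-1) T)

/-- `γ` is (almost everywhere equal to) an affine function on `(-1, 0)`. -/
def IsAffineBeforeZero {d : ℕ} {T : ℝ} (γ : Lp (Vec d) 2 (timeMeasure T)) : Prop :=
  ∃ f : ℝ →ᵃ[ℝ] Vec d, ∀ᵐ t ∂((timeMeasure T).restrict (Ioo (-1) 0)), γ t = f t

/-- The space `Γ` of curves in `L²((-1, T), ℝ^d)` which are affine on `(-1, 0)`,
with the `L²` metric and its Borel `σ`-algebra. -/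
abbrev Curves (d : ℕ) (T : ℝ) : Type :=
  {γ : Lp (Vec d) 2 (timeMeasure T) // IsAffineBeforeZero γ}

section Polish

theorem memLp_affine {d : ℕ} (T : ℝ) (p : Vec d × Vec d) :
    MemLp (fun t : ℝ => p.1 + t • p.2) 2 ((timeMeasure T).restrict (Ioo (-1) 0)) := by
  refine MemLp.of_bound (by fun_prop) (‖p.1‖ + ‖p.2‖) ?_
  filter_upwards [ae_restrict_mem measurableSet_Ioo] with t ht
  refine (norm_add_le _ _).trans (add_le_add le_rfl ?_)
  rw [norm_smul]
  have : ‖t‖ ≤ 1 := by rw [Real.norm_eq_abs, abs_le]; constructor <;> linarith [ht.1, ht.2]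
  nlinarith [norm_nonneg p.2]

/-- Affine functions as elements of `L²`. -/
def affineLp (d : ℕ) (T : ℝ) :
    (Vec d × Vec d) →ₗ[ℝ] Lp (Vec d) 2 ((timeMeasure T).restrict (Ioo (-1) 0)) where
  toFun p := (memLp_affine T p).toLp _
  map_add' p q := by
    rw [← MemLp.toLp_add]
    congr 1
    ext t : 1
    simp only [Prod.fst_add, Prod.snd_add, Pi.add_apply]
    module
  map_smul' c p := by
    simp only [RingHom.id_apply]
    rw [← MemLp.toLp_const_smul]
    congr 1
    ext t : 1
    simp only [Prod.smul_fst, Prod.smul_snd, Pi.smul_apply]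
    module

theorem isClosed_isAffineBeforeZero (d : ℕ) (T : ℝ) :
    IsClosed {γ : Lp (Vec d) 2 (timeMeasure T) | IsAffineBeforeZero γ} := by
  have h : {γ : Lp (Vec d) 2 (timeMeasure T) | IsAffineBeforeZero γ} =
      (LpToLpRestrictCLM ℝ (Vec d) ℝ (timeMeasure T) 2 (Ioo (-1) 0)) ⁻¹'
        (LinearMap.range (affineLp d T) : Set _) := by
    ext γ
    simp only [mem_ofPred_eq, mem_preimage, SetLike.mem_coe, LinearMap.mem_range]
    constructor
    · rintro ⟨f, hf⟩
      refine ⟨(f 0, f.linear 1), ?_⟩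
      apply Lp.ext
      have h1 := (memLp_affine T (f 0, f.linear 1)).coeFn_toLp
      have h2 := LpToLpRestrictCLM_coeFn ℝ (μ := timeMeasure T) (Ioo (-1) 0) γ
      filter_upwards [hf, h1, h2] with t a b c
      change ((memLp_affine T (f 0, f.linear 1)).toLp _ : ℝ → Vec d) t = _
      rw [b, c, a]
      have e := f.map_vadd 0 t
      simp only [vadd_eq_add, add_zero] at e
      rw [e]
      have : f.linear t = t • f.linear 1 := by
        rw [← map_smul]; simp
      rw [this, add_comm]
    · rintro ⟨p, hp⟩
      refine ⟨(AffineMap.const ℝ ℝ p.1) +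
        ((LinearMap.toSpanSingleton ℝ (Vec d) p.2).toAffineMap), ?_⟩
      have h1 := (memLp_affine T p).coeFn_toLp
      have h2 := LpToLpRestrictCLM_coeFn ℝ (μ := timeMeasure T) (Ioo (-1) 0) γ
      rw [← hp] at h2
      filter_upwards [h1, h2] with t b c
      rw [← c]
      change ((memLp_affine T p).toLp _ : ℝ → Vec d) t = _
      rw [b]
      simp
  rw [h]
  exact (Submodule.closed_of_finiteDimensional _).preimage (ContinuousLinearMap.continuous _)

end Polish

instance instPolishSpaceCurves (d : ℕ) (T : ℝ) : PolishSpace (Curves d T) :=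
  haveI : Fact ((2 : ℝ≥0∞) ≠ ⊤) := ⟨ENNReal.ofNat_ne_top⟩
  (isClosed_isAffineBeforeZero d T).polishSpace

instance instNonemptyCurves (d : ℕ) (T : ℝ) : Nonempty (Curves d T) :=
  ⟨⟨0, 0, by
    filter_upwards [ae_restrict_of_ae (Lp.coeFn_zero (Vec d) 2 (timeMeasure T))] with t ht
    change (↑↑(0 : Lp (Vec d) 2 (timeMeasure T)) : ℝ → Vec d) t = _
    rw [ht]
    simp⟩⟩

/-- The affine function on `ℝ` with which the curve `γ` coincides on `(-1, 0)`. -/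
def initialLine {d : ℕ} {T : ℝ} (γ : Curves d T) : ℝ →ᵃ[ℝ] Vec d := γ.2.choose

/-- The initial velocity `W₀(γ) = γ(0) - γ(-1)`. -/
def W₀ {d : ℕ} {T : ℝ} (γ : Curves d T) : Vec d := initialLine γ 0 - initialLine γ (-1)

/-- `v` is the weak (distributional) derivative of `γ` on `(-1, T)`. -/
def IsWeakDeriv {d : ℕ} {T : ℝ} (γ v : Lp (Vec d) 2 (timeMeasure T)) : Prop :=
  ∀ φ : ℝ → ℝ, ContDiff ℝ ∞ φ → HasCompactSupport φ → tsupport φ ⊆ Ioo (-1) T →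
    ∫ t in Ioo (-1) T, deriv φ t • γ t = -∫ t in Ioo (-1) T, φ t • v t

/-- The energy `‖γ̇‖²_{L²(-1, T)}`, with value `∞` if `γ` is not in `W^{1,2}((-1, T), ℝ^d)`. -/
def energy {d : ℕ} {T : ℝ} (γ : Curves d T) : ℝ≥0∞ :=
  ⨅ (v : Lp (Vec d) 2 (timeMeasure T)) (_ : IsWeakDeriv γ.1 v), ‖v‖ₑ ^ 2

/-- The set `M(Γ)` of Borel probability measures on `Γ` with `∫ |γ(0)|² dη ≤ 1` and
`∫ ‖γ̇‖²_{L²(-1, T)} dη ≤ 1`. -/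
def admissible (d : ℕ) (T : ℝ) : Set (ProbabilityMeasure (Curves d T)) :=
  {η | ∫⁻ γ, ‖initialLine γ 0‖ₑ ^ 2 ∂(η : Measure (Curves d T)) ≤ 1 ∧
    ∫⁻ γ, energy γ ∂(η : Measure (Curves d T)) ≤ 1}

open Classical in
/-- The continuous representative of `γ` on `(-1, T)` (the zero function if there is none;
it exists whenever `γ` is in `W^{1,2}`, and is then unique on `(-1, T)`). -/
def contRep {d : ℕ} {T : ℝ} (γ : Curves d T) : ℝ → Vec d :=
  if h : ∃ f : ℝ → Vec d, ContinuousOn f (Ioo (-1) T) ∧ γ.1 =ᵐ[timeMeasure T] f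
  then h.choose else 0

/-- The velocity `γ̇(t)`: the pointwise derivative of the continuous representative, which for
`γ` in `W^{1,2}` exists for almost every `t` and coincides with the weak derivative. -/
def velocity {d : ℕ} {T : ℝ} (γ : Curves d T) (t : ℝ) : Vec d := deriv (contRep γ) t

/-- For `-1 ≤ t`, the measure below is Lebesgue measure on `(t, T)`. -/
theorem timeMeasure_restrict (T t : ℝ) (ht : -1 ≤ t) :
    (timeMeasure T).restrict (Ioo t T) = volume.restrict (Ioo t T) :=
  Measure.restrict_restrict_of_subset (Ioo_subset_Ioo_left ht)

/-- The space `Γ_t = L²((t, T), ℝ^d)` of restricted curves. -/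
abbrev TailCurves (d : ℕ) (T t : ℝ) : Type :=
  Lp (Vec d) 2 ((timeMeasure T).restrict (Ioo t T))

/-- The restriction map `T_t : Γ → Γ_t`. -/
def tail {d : ℕ} {T : ℝ} (t : ℝ) (γ : Curves d T) : TailCurves d T t :=
  LpToLpRestrictCLM ℝ (Vec d) ℝ (timeMeasure T) 2 (Ioo t T) γ.1

/-- The disintegration `γ' ↦ ω^t_{γ'}` of `η` along `T_t`: the regular conditional distribution
of the curve given its restriction to `(t, T)`. -/
def disintegration {d : ℕ} {T : ℝ} (η : ProbabilityMeasure (Curves d T)) (t : ℝ) :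
    Kernel (TailCurves d T t) (Curves d T) :=
  condDistrib id (tail t) (η : Measure (Curves d T))

/-- `V_t(γ) = ∫ W₀(γ') ω^t_{T_t(γ)}(dγ')`. -/
def averageVelocity {d : ℕ} {T : ℝ} (η : ProbabilityMeasure (Curves d T)) (t : ℝ)
    (γ : Curves d T) : Vec d :=
  ∫ γ', W₀ γ' ∂(disintegration η t (tail t γ))

/-- Dissipative solutions: `η ∈ M(Γ)` with `γ̇(t) = V_t(γ)` for `ℒ¹ × η`-a.e. `(t, γ)` in
`[0, T] × Γ`. For each `t` the function `V_t` is only determined up to an `η`-null set, so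
`(t, γ) ↦ V_t(γ)` is taken in a jointly measurable version `V`
(which is unique up to `ℒ¹ × η`-null sets). -/
def IsDissipativeSolution {d : ℕ} {T : ℝ} (η : ProbabilityMeasure (Curves d T)) : Prop :=
  η ∈ admissible d T ∧
    ∃ V : ℝ × Curves d T → Vec d, Measurable V ∧
      (∀ᵐ t ∂(volume.restrict (Icc 0 T)),
        ∀ᵐ γ ∂(η : Measure (Curves d T)), V (t, γ) = averageVelocity η t γ) ∧
      ∀ᵐ p ∂((volume.restrict (Icc 0 T)).prod (η : Measure (Curves d T))),
        velocity p.2 p.1 = V p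

end PressurelessEuler

end

/-! Since V_t is a version of the conditional expectation of W₀ given the future T_t, the defining
equation reads γ̇(t) = E[W₀ | T_t]. Conditional expectations are not narrowly continuous in η, so
the equation is traded for an equivalent family of linear conditions on η, `IsBalanced`: the
integral of f(⟨g, γ⟩ on (s, T)) times the pairing of ∫ χ(t) (W₀ - γ̇(t)) dt with e vanishes whenever
χ is supported in (0, s). Keeping the support of χ before s makes the factor f(...) a function of
the future at every time t where χ(t) ≠ 0. Integrating by parts in t turns the velocity term into
`defect`, which is continuous on Γ and grows at most linearly in the norm of γ.

Compactness: the energy is lower semicontinuous by weak compactness of balls in L², and curves with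
bounded γ(0) and bounded energy form a compact set by Arzelà-Ascoli. Markov's inequality and
Prokhorov's theorem then make `admissible` compact (`isCompact_admissible`). Second moments are
uniformly bounded there, so each balance condition is closed despite the unbounded integrand
(`isCompact_setOf_isBalanced`).

Equivalence: a dissipative solution is balanced by orthogonality of W₀ - E[W₀ | T_t] to functions of
the future. Conversely, γ̇(t) agrees almost everywhere with `futureVelocity`, which is built from
right derivatives and is therefore a function of the future. Localising the balance condition in t,
letting s decrease to t, and taking f = cos and f = sin, uniqueness of Fourier transforms on the
Hilbert space Γ_t gives E[W₀ - γ̇(t) | T_t] = 0; since γ̇(t) is itself a function of the future, it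
equals V_t. -/

noncomputable section

namespace PressurelessEuler

open Filter Topology TopologicalSpace

/-! ### Initial position and velocity as continuous moments over (-1, 0). -/

section Functionals

variable {E : Type*} [NormedAddCommGroup E] [NormedSpace ℝ E] [CompleteSpace E]

/-- Integration against a fixed scalar `L²` weight is continuous on `L²`. -/
theorem continuous_integral_smul {α : Type*} {m : MeasurableSpace α} {μ : Measure α} {k : α → ℝ}
    (hk : MemLp k 2 μ) : Continuous fun γ : Lp E 2 μ => ∫ t, k t • γ t ∂μ := by
  have h := ((ContinuousLinearMap.lsmul ℝ ℝ : ℝ →L[ℝ] E →L[ℝ] E).lpPairing μ 2 2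
    (hk.toLp k)).continuous
  refine h.congr fun γ => ?_
  rw [ContinuousLinearMap.lpPairing_eq_integral]
  refine integral_congr_ae ?_
  filter_upwards [hk.coeFn_toLp] with t ht
  simp [ht]

end Functionals

variable {d : ℕ} {T : ℝ}

/-- Affine weights on the time interval before `0` are in `L²`. -/
theorem memLp_indicator_poly (T a b : ℝ) :
    MemLp ((Ioo (-1 : ℝ) 0).indicator fun t => a * t + b) 2 (timeMeasure T) := by
  refine MemLp.of_bound
    ((by fun_prop : Measurable fun t : ℝ => a * t + b).indicator
      measurableSet_Ioo).aestronglyMeasurable (|a| + |b|) (Eventually.of_forall fun t => ?_)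
  by_cases ht : t ∈ Ioo (-1 : ℝ) 0
  · rw [indicator_of_mem ht, Real.norm_eq_abs]
    refine (abs_add_le _ _).trans (add_le_add ?_ le_rfl)
    rw [abs_mul]
    have : |t| ≤ 1 := by rw [abs_le]; constructor <;> linarith [ht.1, ht.2]
    nlinarith [abs_nonneg a]
  · rw [indicator_of_notMem ht]
    simp only [norm_zero]; positivity

theorem integral_quadratic (q₀ q₁ q₂ : ℝ) :
    ∫ t in (-1 : ℝ)..0, (q₀ + q₁ * t + q₂ * t ^ 2) = q₀ - q₁ / 2 + q₂ / 3 := by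
  have h : ∀ x ∈ uIcc (-1 : ℝ) 0, HasDerivAt
      (fun t : ℝ => q₀ * t + q₁ * (t ^ 2 / 2) + q₂ * (t ^ 3 / 3)) (q₀ + q₁ * x + q₂ * x ^ 2) x := by
    intro x _
    have h1 := ((hasDerivAt_id x).const_mul q₀)
    have h2 := ((hasDerivAt_pow 2 x).div_const 2).const_mul q₁
    have h3 := ((hasDerivAt_pow 3 x).div_const 3).const_mul q₂
    convert! (h1.add h2).add h3 using 1
    simp
  rw [intervalIntegral.integral_eq_sub_of_hasDerivAt h
    ((by fun_prop : Continuous fun t : ℝ => q₀ + q₁ * t + q₂ * t ^ 2).intervalIntegrable _ _)]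
  ring

theorem affineMap_apply_eq (f : ℝ →ᵃ[ℝ] Vec d) (t : ℝ) : f t = f 0 + t • (f 0 - f (-1)) := by
  have key : ∀ s : ℝ, f s = f 0 + s • f.linear 1 := fun s => by
    have e := f.map_vadd 0 s
    simp only [vadd_eq_add, add_zero] at e
    rw [e, add_comm, show f.linear s = s • f.linear 1 by rw [← map_smul]; simp]
  rw [key t, key (-1)]
  simp

/-- Moments of a curve over `(-1, 0)` in terms of its initial affine function. -/
theorem integral_indicator_smul_curve (hT : 0 < T) (γ : Curves d T) (a b : ℝ) :
    ∫ t, ((Ioo (-1 : ℝ) 0).indicator (fun t => a * t + b) t) • γ.1 t ∂(timeMeasure T) =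
      (b - a / 2) • initialLine γ 0 + (a / 3 - b / 2) • W₀ γ := by
  have hsub : (timeMeasure T).restrict (Ioo (-1 : ℝ) 0) = volume.restrict (Ioo (-1 : ℝ) 0) :=
    Measure.restrict_restrict_of_subset (Ioo_subset_Ioo_right hT.le)
  have h1 : ∀ t, ((Ioo (-1 : ℝ) 0).indicator (fun t => a * t + b) t) • γ.1 t =
      (Ioo (-1 : ℝ) 0).indicator (fun t => (a * t + b) • γ.1 t) t := fun t => by
    by_cases ht : t ∈ Ioo (-1 : ℝ) 0 <;> simp [ht]
  simp_rw [h1]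
  rw [integral_indicator measurableSet_Ioo]
  have h2 := γ.2.choose_spec
  have h3 : ∫ t in Ioo (-1 : ℝ) 0, (a * t + b) • γ.1 t ∂(timeMeasure T) =
      ∫ t in Ioo (-1 : ℝ) 0, ((a * t + b) • initialLine γ 0 + ((a * t + b) * t) • W₀ γ)
        ∂(timeMeasure T) := by
    refine integral_congr_ae ?_
    filter_upwards [h2] with t ht
    rw [ht]
    change (a * t + b) • initialLine γ t = _
    rw [affineMap_apply_eq (initialLine γ) t, smul_add, smul_smul]
    rfl
  rw [h3, hsub, ← integral_Ioc_eq_integral_Ioo,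
    ← intervalIntegral.integral_of_le (by norm_num : (-1 : ℝ) ≤ 0),
    intervalIntegral.integral_add, intervalIntegral.integral_smul_const,
    intervalIntegral.integral_smul_const]
  · have e1 := integral_quadratic b a 0
    have e2 := integral_quadratic 0 b a
    simp only [zero_mul, add_zero, zero_div, zero_add] at e1 e2
    congr 2
    · rw [← e1]; congr 1; ext t; ring
    · rw [show a / 3 - b / 2 = 0 - b / 2 + a / 3 by ring, ← e2]; congr 1; ext t; ring
  · exact Continuous.intervalIntegrable (by fun_prop) _ _
  · exact Continuous.intervalIntegrable (by fun_prop) _ _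

/-- `W₀` is defined through a chosen affine function, so continuity is read off from a moment
formula. The weight a t + b solves b - a/2 = 0 and a/3 - b/2 = 1; for γ(0) below, the two right-hand
sides are exchanged, giving 6t + 4. -/
theorem W₀_eq_integral (hT : 0 < T) (γ : Curves d T) :
    W₀ γ = ∫ t, ((Ioo (-1 : ℝ) 0).indicator (fun t => 12 * t + 6) t) • γ.1 t ∂(timeMeasure T) := by
  rw [integral_indicator_smul_curve hT]
  norm_num

theorem initialLine_zero_eq_integral (hT : 0 < T) (γ : Curves d T) : initialLine γ 0 =
    ∫ t, ((Ioo (-1 : ℝ) 0).indicator (fun t => 6 * t + 4) t) • γ.1 t ∂(timeMeasure T) := by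
  rw [integral_indicator_smul_curve hT]
  norm_num

theorem continuous_W₀ (hT : 0 < T) : Continuous (W₀ : Curves d T → Vec d) :=
  ((continuous_integral_smul (memLp_indicator_poly T 12 6)).comp continuous_subtype_val).congr
    fun γ => (W₀_eq_integral hT γ).symm

theorem continuous_initialLine_zero (hT : 0 < T) :
    Continuous fun γ : Curves d T => initialLine γ 0 :=
  ((continuous_integral_smul (memLp_indicator_poly T 6 4)).comp continuous_subtype_val).congr
    fun γ => (initialLine_zero_eq_integral hT γ).symm

/-! ### Weak derivatives, primitives and the continuous representative. -/

/-- The extension by zero of an `L²` function on the time interval. -/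
def zeroExt (v : Lp (Vec d) 2 (timeMeasure T)) : ℝ → Vec d := (Ioo (-1) T).indicator v

theorem integrable_timeMeasure (v : Lp (Vec d) 2 (timeMeasure T)) : Integrable v (timeMeasure T) :=
  (Lp.memLp v).integrable (by norm_num)

theorem integrable_zeroExt (v : Lp (Vec d) 2 (timeMeasure T)) : Integrable (zeroExt v) :=
  (integrable_indicator_iff measurableSet_Ioo).2 (integrable_timeMeasure v)

/-- Cauchy-Schwarz against the indicator of A times the vector e, where e is the integral itself;
dividing by ‖e‖ gives the bound. -/
theorem norm_setIntegral_le {α : Type*} {m : MeasurableSpace α} {μ : Measure α}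
    (v : Lp (Vec d) 2 μ) {A : Set α} (hA : MeasurableSet A) (hμA : μ A ≠ ⊤) :
    ‖∫ t in A, v t ∂μ‖ ≤ √(μ.real A) * ‖v‖ := by
  set e := ∫ t in A, v t ∂μ with he
  have h1 := L2.inner_indicatorConstLp_eq_inner_setIntegral ℝ hA hμA e v
  have h2 := real_inner_le_norm (indicatorConstLp 2 hA hμA e) v
  rw [h1, ← he, real_inner_self_eq_norm_sq, norm_indicatorConstLp (by norm_num) (by norm_num)] at h2
  have h3 : μ.real A ^ (1 / (2 : ℝ≥0∞).toReal) = √(μ.real A) := by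
    rw [Real.sqrt_eq_rpow]; norm_num
  rw [h3] at h2
  by_contra hlt
  push Not at hlt
  have h4 : 0 < ‖e‖ := lt_of_le_of_lt (by positivity) hlt
  nlinarith

theorem norm_integral_zeroExt_sub_le (v : Lp (Vec d) 2 (timeMeasure T)) (x y : ℝ) :
    ‖∫ s in x..y, zeroExt v s‖ ≤ √|y - x| * ‖v‖ := by
  have h1 : ∀ A : Set ℝ, MeasurableSet A →
      ∫ s in A, zeroExt v s = ∫ s in A, v s ∂(timeMeasure T) := fun A hA => by
    rw [zeroExt, integral_indicator measurableSet_Ioo, Measure.restrict_restrict measurableSet_Ioo,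
      Measure.restrict_restrict hA, inter_comm]
  rw [intervalIntegral.norm_intervalIntegral_eq, h1 _ measurableSet_uIoc]
  have hfin : (volume : Measure ℝ) (uIoc x y) ≠ ⊤ := by simp
  have hle : timeMeasure T (uIoc x y) ≤ volume (uIoc x y) := Measure.restrict_apply_le _ _
  refine (norm_setIntegral_le v measurableSet_uIoc (ne_top_of_le_ne_top hfin hle)).trans ?_
  refine mul_le_mul_of_nonneg_right (Real.sqrt_le_sqrt ?_) (norm_nonneg _)
  refine (ENNReal.toReal_mono hfin hle).trans ?_
  simp

theorem exists_Icc_of_isCompact_subset_Ioo {K : Set ℝ} (hK : IsCompact K) (hne : K.Nonempty)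
    {a b : ℝ} (h : K ⊆ Ioo a b) : ∃ a' b', K ⊆ Icc a' b' ∧ Icc a' b' ⊆ Ioo a b := by
  obtain ⟨x, hx, hx'⟩ := hK.exists_isLeast hne
  obtain ⟨y, hy, hy'⟩ := hK.exists_isGreatest hne
  exact ⟨x, y, fun z hz => ⟨hx' hz, hy' hz⟩, Icc_subset_Ioo (h hx).1 (h hy).2⟩

/-- A test function with vanishing integral is the derivative of a test function. -/
theorem exists_antideriv {ψ : ℝ → ℝ} {a b : ℝ} (hψ : ContDiff ℝ ∞ ψ) (hc : HasCompactSupport ψ)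
    (hs : tsupport ψ ⊆ Ioo a b) (h0 : ∫ t, ψ t = 0) :
    ∃ Φ : ℝ → ℝ, ContDiff ℝ ∞ Φ ∧ HasCompactSupport Φ ∧ tsupport Φ ⊆ Ioo a b ∧ deriv Φ = ψ := by
  rcases (tsupport ψ).eq_empty_or_nonempty with hem | hne
  · rw [tsupport_eq_empty_iff] at hem
    subst hem
    exact ⟨0, contDiff_const, HasCompactSupport.zero, by simp, by ext; simp⟩
  obtain ⟨a', b', h1, h2⟩ := exists_Icc_of_isCompact_subset_Ioo hc hne hs
  have hint : Integrable ψ := hψ.continuous.integrable_of_hasCompactSupport hc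
  have hder : ∀ x, HasDerivAt (fun x => ∫ t in a'..x, ψ t) (ψ x) x := fun x =>
    intervalIntegral.integral_hasDerivAt_right (hint.intervalIntegrable)
      (hψ.continuous.stronglyMeasurableAtFilter _ _) hψ.continuous.continuousAt
  have hd : deriv (fun x => ∫ t in a'..x, ψ t) = ψ := funext fun x => (hder x).deriv
  have hz : ∀ x, x ∉ Icc a' b' → ψ x = 0 := fun x hx =>
    image_eq_zero_of_notMem_tsupport fun h => hx (h1 h)
  have hsupp : Function.support (fun x => ∫ t in a'..x, ψ t) ⊆ Icc a' b' := by
    intro x hx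
    by_contra hnot
    refine hx ?_
    rcases lt_or_ge x a' with h | h
    · change ∫ t in a'..x, ψ t = 0
      rw [intervalIntegral.integral_of_ge h.le, ← integral_Ico_eq_integral_Ioc,
        setIntegral_eq_zero_of_forall_eq_zero, neg_zero]
      exact fun t ht => hz t fun h' => (ht.2.trans_le h'.1).false
    · have hbx : b' < x := by
        by_contra hh; exact hnot ⟨h, not_lt.1 hh⟩
      change ∫ t in a'..x, ψ t = 0
      -- To the right of b' the primitive has collected the whole integral of ψ, which is zero by
      -- assumption.
      rw [intervalIntegral.integral_of_le h, ← integral_Icc_eq_integral_Ioc,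
        setIntegral_eq_integral_of_forall_compl_eq_zero, h0]
      intro t ht
      exact hz t fun h' => ht ⟨h'.1, h'.2.trans hbx.le⟩
  have hts : tsupport (fun x => ∫ t in a'..x, ψ t) ⊆ Icc a' b' :=
    closure_minimal hsupp isClosed_Icc
  refine ⟨fun x => ∫ t in a'..x, ψ t, ?_, ?_, hts.trans h2, hd⟩
  · rw [contDiff_infty_iff_deriv]
    exact ⟨fun x => (hder x).differentiableAt, by rwa [hd]⟩
  · exact HasCompactSupport.of_support_subset_isCompact isCompact_Icc hsupp

theorem exists_testFunction_integral_eq_one {a b : ℝ} (hab : a < b) :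
    ∃ ρ : ℝ → ℝ, ContDiff ℝ ∞ ρ ∧ HasCompactSupport ρ ∧ tsupport ρ ⊆ Ioo a b ∧ ∫ t, ρ t = 1 := by
  have hpos : 0 < (b - a) / 4 := by linarith
  let f : ContDiffBump ((a + b) / 2) := ⟨(b - a) / 8, (b - a) / 4, by linarith, by linarith⟩
  refine ⟨f.normed volume, f.contDiff_normed, f.hasCompactSupport_normed, ?_, f.integral_normed⟩
  rw [f.tsupport_normed_eq, Real.closedBall_eq_Icc]
  exact Icc_subset_Ioo (by change a < (a + b) / 2 - (b - a) / 4; linarith)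
    (by change (a + b) / 2 + (b - a) / 4 < b; linarith)

theorem integral_smul_eq_of_tsupport_subset {E : Type*} [NormedAddCommGroup E] [NormedSpace ℝ E]
    {φ : ℝ → ℝ} {s : Set ℝ} (hs : tsupport φ ⊆ s) (f : ℝ → E) :
    ∫ t in s, φ t • f t = ∫ t, φ t • f t :=
  setIntegral_eq_integral_of_forall_compl_eq_zero fun t ht => by
    rw [image_eq_zero_of_notMem_tsupport fun h => ht (hs h), zero_smul]

/-- Fubini on the half-plane s < x: for fixed s, the integral of φ' over (s, ∞) is -φ(s). It shows
that a primitive of w has weak derivative w. -/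
theorem integral_deriv_smul_integral_Iio {E : Type*} [NormedAddCommGroup E] [NormedSpace ℝ E]
    [CompleteSpace E]
    {φ : ℝ → ℝ} (hφ : ContDiff ℝ ∞ φ) (hc : HasCompactSupport φ) {w : ℝ → E} (hw : Integrable w) :
    ∫ x, deriv φ x • ∫ s in Iio x, w s = -∫ s, φ s • w s := by
  have hd : Integrable (deriv φ) :=
    (hφ.continuous_deriv (by simp)).integrable_of_hasCompactSupport hc.deriv
  have hprod : Integrable (fun p : ℝ × ℝ => {p : ℝ × ℝ | p.2 < p.1}.indicator
      (fun p => deriv φ p.1 • w p.2) p) (volume.prod volume) :=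
    (hd.smul_prod hw).indicator (measurableSet_lt measurable_snd measurable_fst)
  have h1 : ∀ x, deriv φ x • ∫ s in Iio x, w s = ∫ s, {p : ℝ × ℝ | p.2 < p.1}.indicator
      (fun p => deriv φ p.1 • w p.2) (x, s) := fun x => by
    rw [← integral_smul, ← integral_indicator measurableSet_Iio]
    rfl
  have h2 : ∀ s, ∫ x, {p : ℝ × ℝ | p.2 < p.1}.indicator
      (fun p => deriv φ p.1 • w p.2) (x, s) = -(φ s • w s) := fun s => by
    rw [← neg_smul, ← hc.integral_Ioi_deriv_eq (hφ.of_le (by simp)) s, ← integral_smul_const,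
      ← integral_indicator measurableSet_Ioi]
    rfl
  simp_rw [h1]
  rw [integral_integral_swap hprod]
  simp_rw [h2]
  exact integral_neg _

/-- The du Bois-Reymond lemma. -/
theorem exists_ae_eq_const_of_integral_deriv_smul_eq_zero {E : Type*} [NormedAddCommGroup E]
    [NormedSpace ℝ E] [CompleteSpace E] {a b : ℝ} (hab : a < b) {z : ℝ → E}
    (hz : LocallyIntegrable z)
    (h : ∀ φ : ℝ → ℝ, ContDiff ℝ ∞ φ → HasCompactSupport φ → tsupport φ ⊆ Ioo a b →
      ∫ t, deriv φ t • z t = 0) : ∃ c, ∀ᵐ t, t ∈ Ioo a b → z t = c := by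
  obtain ⟨ρ, hρ, hρc, hρs, hρ1⟩ := exists_testFunction_integral_eq_one hab
  have hi : ∀ ψ : ℝ → ℝ, ContDiff ℝ ∞ ψ → HasCompactSupport ψ →
      Integrable (fun t => ψ t • z t) := fun ψ hψ hc =>
    hz.integrable_smul_left_of_hasCompactSupport hψ.continuous hc
  refine ⟨∫ t, ρ t • z t, ?_⟩
  have key := isOpen_Ioo.ae_eq_zero_of_integral_contDiff_smul_eq_zero (μ := volume)
    (U := Ioo a b) (f := fun t => z t - ∫ t, ρ t • z t)
    ((hz.sub (locallyIntegrable_const _)).locallyIntegrableOn _) ?_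
  · filter_upwards [key] with t ht hm
    exact sub_eq_zero.1 (ht hm)
  intro ψ hψ hψc hψs
  set m := ∫ t, ψ t with hm
  -- Subtracting m ρ removes the mean of ψ, so the difference is the derivative of a test function
  -- and the hypothesis applies to it.
  have hψρ : ContDiff ℝ ∞ (fun t => ψ t - m * ρ t) := hψ.sub (contDiff_const.mul hρ)
  have hsub : Function.support (fun t => ψ t - m * ρ t) ⊆ tsupport ψ ∪ tsupport ρ := by
    intro t ht
    by_contra hnot
    rw [mem_union, not_or] at hnot
    exact ht (by simp [image_eq_zero_of_notMem_tsupport hnot.1,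
      image_eq_zero_of_notMem_tsupport hnot.2])
  have hψi := hψ.continuous.integrable_of_hasCompactSupport (μ := volume) hψc
  have hρi := hρ.continuous.integrable_of_hasCompactSupport (μ := volume) hρc
  obtain ⟨Φ, hΦ, hΦc, hΦs, hΦd⟩ := exists_antideriv (a := a) (b := b) hψρ
    (HasCompactSupport.of_support_subset_isCompact (hψc.isCompact.union hρc.isCompact) hsub)
    ((closure_minimal hsub ((isClosed_tsupport _).union (isClosed_tsupport _))).trans
      (union_subset hψs hρs))
    (by rw [integral_sub hψi (hρi.const_mul m), integral_const_mul, hρ1, ← hm]; ring)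
  have h0 := h Φ hΦ hΦc hΦs
  rw [hΦd] at h0
  simp only [sub_smul, mul_smul] at h0
  rw [integral_sub (hi ψ hψ hψc) ((hi ρ hρ hρc).fun_smul m), integral_smul, sub_eq_zero] at h0
  simp only [smul_sub]
  rw [integral_sub (hi ψ hψ hψc) (hψi.smul_const _), integral_smul_const, h0, ← hm, sub_self]

theorem intervalIntegral_zeroExt_continuous (v : Lp (Vec d) 2 (timeMeasure T)) :
    Continuous fun x => ∫ s in (0 : ℝ)..x, zeroExt v s :=
  intervalIntegral.continuous_primitive (fun _ _ => (integrable_zeroExt v).intervalIntegrable) 0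

/-- A curve with a weak derivative is the primitive of it. -/
theorem IsWeakDeriv.exists_ae_eq (hT : 0 < T) {γ v : Lp (Vec d) 2 (timeMeasure T)}
    (h : IsWeakDeriv γ v) :
    ∃ c, γ =ᵐ[timeMeasure T] fun x => c + ∫ s in (0 : ℝ)..x, zeroExt v s := by
  have hv := integrable_zeroExt v
  have hγ := integrable_zeroExt γ
  have hcont : Continuous fun x => ∫ s in Iio x, zeroExt v s := by
    have e : (fun x => ∫ s in Iio x, zeroExt v s) = fun x =>
        (∫ s in Iic (0 : ℝ), zeroExt v s) + ∫ s in (0 : ℝ)..x, zeroExt v s := by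
      ext1 x
      rw [← intervalIntegral.integral_Iic_sub_Iic hv.integrableOn hv.integrableOn,
        ← integral_Iic_eq_integral_Iio]
      abel
    rw [e]
    exact continuous_const.add (intervalIntegral_zeroExt_continuous v)
  -- The curve and the primitive of v have the same weak derivative, so their difference is
  -- constant. The primitive starts at -∞ here to fit the Fubini identity; the base point is moved
  -- to 0 at the end.
  obtain ⟨c, hc⟩ := exists_ae_eq_const_of_integral_deriv_smul_eq_zero
    (a := -1) (b := T) (by linarith)
    (z := fun x => zeroExt γ x - ∫ s in Iio x, zeroExt v s)
    (hγ.locallyIntegrable.sub hcont.locallyIntegrable) (by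
      intro φ hφ hφc hφs
      have h1 := h φ hφ hφc hφs
      have e1 : ∫ t in Ioo (-1) T, deriv φ t • γ t = ∫ t, deriv φ t • zeroExt γ t := by
        rw [← integral_indicator measurableSet_Ioo]
        congr 1; ext1 t
        by_cases ht : t ∈ Ioo (-1) T <;> simp [zeroExt, ht]
      have e2 : ∫ t in Ioo (-1) T, φ t • v t = ∫ t, φ t • zeroExt v t := by
        rw [← integral_indicator measurableSet_Ioo]
        congr 1; ext1 t
        by_cases ht : t ∈ Ioo (-1) T <;> simp [zeroExt, ht]
      rw [e1, e2, ← integral_deriv_smul_integral_Iio hφ hφc hv] at h1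
      have hd := hφ.continuous_deriv (by simp)
      simp only [smul_sub]
      rw [integral_sub (hγ.locallyIntegrable.integrable_smul_left_of_hasCompactSupport hd hφc.deriv)
        (hcont.locallyIntegrable.integrable_smul_left_of_hasCompactSupport hd hφc.deriv),
        h1, sub_self])
  refine ⟨c + ∫ s in Iic (0 : ℝ), zeroExt v s, ?_⟩
  filter_upwards [ae_restrict_of_ae hc, ae_restrict_mem measurableSet_Ioo] with t ht hm
  have := ht hm
  rw [zeroExt, indicator_of_mem hm] at this
  rw [← intervalIntegral.integral_Iic_sub_Iic hv.integrableOn hv.integrableOn,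
    add_assoc, add_sub_cancel, integral_Iic_eq_integral_Iio, ← this]
  abel

/-- The constant is identified by continuity: the primitive and the initial affine function agree on
(-1, 0), hence also at the endpoint 0, where the integral vanishes. -/
theorem IsWeakDeriv.ae_eq (hT : 0 < T) {γ : Curves d T} {v : Lp (Vec d) 2 (timeMeasure T)}
    (h : IsWeakDeriv γ.1 v) : γ.1 =ᵐ[timeMeasure T]
      fun x => initialLine γ 0 + ∫ s in (0 : ℝ)..x, zeroExt v s := by
  obtain ⟨c, hc⟩ := h.exists_ae_eq hT
  have hsub : (timeMeasure T).restrict (Ioo (-1 : ℝ) 0) = volume.restrict (Ioo (-1 : ℝ) 0) :=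
    Measure.restrict_restrict_of_subset (Ioo_subset_Ioo_right hT.le)
  have h1 := γ.2.choose_spec
  have h2 : (fun x => c + ∫ s in (0 : ℝ)..x, zeroExt v s)
      =ᵐ[volume.restrict (Ioo (-1 : ℝ) 0)] initialLine γ := by
    rw [← hsub]
    filter_upwards [ae_restrict_of_ae hc, h1] with t h3 h4
    rw [← h3, h4]
    rfl
  have hcont : Continuous fun x => c + ∫ s in (0 : ℝ)..x, zeroExt v s :=
    continuous_const.add (intervalIntegral_zeroExt_continuous v)
  have hline : Continuous (initialLine γ) := AffineMap.continuous_of_finiteDimensional _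
  have h3 := (Measure.eqOn_Ioo_of_ae_eq volume h2 hcont.continuousOn hline.continuousOn).closure
    hcont hline
  rw [closure_Ioo (by norm_num)] at h3
  have h4 : c = initialLine γ 0 := by simpa using h3 (show (0 : ℝ) ∈ Icc (-1) 0 by norm_num)
  rw [← h4]
  exact hc

/-- Makes the choice in `contRep` harmless: continuous functions that agree almost everywhere on an
open interval agree everywhere on it. -/
theorem contRep_eqOn {γ : Curves d T} {f : ℝ → Vec d} (hf : ContinuousOn f (Ioo (-1) T))
    (h : γ.1 =ᵐ[timeMeasure T] f) : EqOn (contRep γ) f (Ioo (-1) T) := by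
  have hex : ∃ f : ℝ → Vec d, ContinuousOn f (Ioo (-1) T) ∧ γ.1 =ᵐ[timeMeasure T] f := ⟨f, hf, h⟩
  have e : contRep γ = hex.choose := by rw [contRep, dif_pos hex]
  rw [e]
  exact Measure.eqOn_Ioo_of_ae_eq volume (hex.choose_spec.2.symm.trans h) hex.choose_spec.1 hf

theorem IsWeakDeriv.contRep_eqOn (hT : 0 < T) {γ : Curves d T}
    {v : Lp (Vec d) 2 (timeMeasure T)} (h : IsWeakDeriv γ.1 v) :
    EqOn (contRep γ) (fun x => initialLine γ 0 + ∫ s in (0 : ℝ)..x, zeroExt v s) (Ioo (-1) T) :=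
  PressurelessEuler.contRep_eqOn
    (continuous_const.add (intervalIntegral_zeroExt_continuous v)).continuousOn (h.ae_eq hT)

/-- Lebesgue differentiation of the primitive. -/
theorem IsWeakDeriv.ae_hasDerivAt (hT : 0 < T) {γ : Curves d T}
    {v : Lp (Vec d) 2 (timeMeasure T)} (h : IsWeakDeriv γ.1 v) :
    ∀ᵐ t ∂(timeMeasure T), HasDerivAt (contRep γ) (v t) t := by
  filter_upwards [ae_restrict_of_ae
    (_root_.LocallyIntegrable.ae_hasDerivAt_integral (integrable_zeroExt v).locallyIntegrable),
    ae_restrict_mem measurableSet_Ioo] with t ht hm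
  have h1 := (ht 0).const_add (initialLine γ 0)
  rw [zeroExt, indicator_of_mem hm] at h1
  exact h1.congr_of_eventuallyEq
    (Filter.eventuallyEq_of_mem (isOpen_Ioo.mem_nhds hm) (h.contRep_eqOn hT))

theorem IsWeakDeriv.unique {γ v v' : Lp (Vec d) 2 (timeMeasure T)}
    (h : IsWeakDeriv γ v) (h' : IsWeakDeriv γ v') : v = v' := by
  have hl : ∀ w : Lp (Vec d) 2 (timeMeasure T), IntegrableOn w (Ioo (-1) T) volume :=
    integrable_timeMeasure
  have key := isOpen_Ioo.ae_eq_zero_of_integral_contDiff_smul_eq_zero (μ := volume)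
    (U := Ioo (-1) T) (f := fun t => v t - v' t)
    ((hl v).locallyIntegrableOn.sub (hl v').locallyIntegrableOn) (by
      intro φ hφ hφc hφs
      have hi : ∀ w : Lp (Vec d) 2 (timeMeasure T), IntegrableOn (fun t => φ t • w t)
          (Ioo (-1) T) volume := fun w => by
        obtain ⟨C, hC⟩ := hφ.continuous.bounded_above_of_compact_support hφc
        exact (hl w).bdd_smul C hφ.continuous.aestronglyMeasurable (Eventually.of_forall hC)
      rw [← integral_smul_eq_of_tsupport_subset hφs]
      simp only [smul_sub]
      rw [integral_sub (hi v) (hi v'), sub_eq_zero, ← neg_inj, ← h φ hφ hφc hφs,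
        ← h' φ hφ hφc hφs])
  apply Lp.ext
  filter_upwards [ae_restrict_of_ae key, ae_restrict_mem measurableSet_Ioo] with t ht hm
  exact sub_eq_zero.1 (ht hm)

theorem IsWeakDeriv.energy_eq {γ : Curves d T} {v : Lp (Vec d) 2 (timeMeasure T)}
    (h : IsWeakDeriv γ.1 v) : energy γ = ‖v‖ₑ ^ 2 := by
  refine le_antisymm (iInf₂_le v h) (le_iInf₂ fun w hw => ?_)
  rw [h.unique hw]

theorem exists_isWeakDeriv_of_energy_ne_top {γ : Curves d T} (h : energy γ ≠ ⊤) :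
    ∃ v, IsWeakDeriv γ.1 v := by
  by_contra hne
  push Not at hne
  exact h (by simp [energy, hne])

theorem energy_le_ofReal_sq_iff {γ : Curves d T} {r : ℝ} (hr : 0 ≤ r) :
    energy γ ≤ ENNReal.ofReal (r ^ 2) ↔ ∃ v, ‖v‖ ≤ r ∧ IsWeakDeriv γ.1 v := by
  have e : ∀ v : Lp (Vec d) 2 (timeMeasure T), ‖v‖ₑ ^ 2 ≤ ENNReal.ofReal (r ^ 2) ↔ ‖v‖ ≤ r :=
    fun v => by
      rw [← ofReal_norm, ← ENNReal.ofReal_pow (norm_nonneg _),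
        ENNReal.ofReal_le_ofReal_iff (by positivity), sq_le_sq₀ (norm_nonneg _) hr]
  constructor
  · intro h
    obtain ⟨v, hv⟩ := exists_isWeakDeriv_of_energy_ne_top (ne_top_of_le_ne_top (by simp) h)
    exact ⟨v, (e v).1 (hv.energy_eq ▸ h), hv⟩
  · rintro ⟨v, hv, hw⟩
    rw [hw.energy_eq]
    exact (e v).2 hv

/-! ### Lower semicontinuity of the energy and compactness of its sublevels. -/

/-- The quantifier over v is a projection along the closed r-ball of the dual, which is weak-*
compact by Banach-Alaoglu. Tested against φ and a vector e, the weak derivative relation is closed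
in the pair (γ, functional), and projection along a compact factor is a closed map. The Riesz
isomorphism translates between v and functionals. -/
theorem isClosed_setOf_exists_isWeakDeriv (d : ℕ) (T r : ℝ) :
    IsClosed {γ : Lp (Vec d) 2 (timeMeasure T) | ∃ v, ‖v‖ ≤ r ∧ IsWeakDeriv γ v} := by
  let H := Lp (Vec d) 2 (timeMeasure T)
  let K : Set (WeakDual ℝ H) := WeakDual.toStrongDual ⁻¹' Metric.closedBall 0 r
  have : CompactSpace K := isCompact_iff_compactSpace.1 (WeakDual.isCompact_closedBall 0 r)
  have hmem : ∀ {φ : ℝ → ℝ}, Continuous φ → HasCompactSupport φ →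
      MemLp φ 2 (timeMeasure T) := fun h hc => h.memLp_of_hasCompactSupport hc
  have hmem' : ∀ {φ : ℝ → ℝ}, Continuous φ → HasCompactSupport φ → ∀ e : Vec d,
      MemLp (fun t => φ t • e) 2 (timeMeasure T) := fun h hc e =>
    (h.smul continuous_const).memLp_of_hasCompactSupport hc.smul_right
  let S : Set (H × K) := {p | ∀ (φ : ℝ → ℝ) (hφ : ContDiff ℝ ∞ φ) (hc : HasCompactSupport φ),
    tsupport φ ⊆ Ioo (-1) T → ∀ e : Vec d,
      inner ℝ (∫ t in Ioo (-1) T, deriv φ t • p.1 t) e =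
        -(p.2 : WeakDual ℝ H) ((hmem' hφ.continuous hc e).toLp _)}
  have hS : IsClosed S := by
    have : S = ⋂ (φ : ℝ → ℝ) (hφ : ContDiff ℝ ∞ φ) (hc : HasCompactSupport φ)
      (_ : tsupport φ ⊆ Ioo (-1) T) (e : Vec d), {p : H × K |
      inner ℝ (∫ t in Ioo (-1) T, deriv φ t • p.1 t) e =
        -(p.2 : WeakDual ℝ H) ((hmem' hφ.continuous hc e).toLp _)} := by
      ext p; simp only [S, mem_iInter, mem_ofPred_eq]
    rw [this]
    refine isClosed_iInter fun φ => isClosed_iInter fun hφ => isClosed_iInter fun hc =>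
      isClosed_iInter fun _ => isClosed_iInter fun e => isClosed_eq ?_ ?_
    · exact ((continuous_integral_smul
        (hmem (hφ.continuous_deriv (by simp)) hc.deriv)).comp continuous_fst).inner
          continuous_const
    · exact ((WeakDual.eval_continuous _).comp
        (continuous_subtype_val.comp continuous_snd)).neg
  have himg : {γ : H | ∃ v, ‖v‖ ≤ r ∧ IsWeakDeriv γ v} = Prod.fst '' S := by
    have hpair : ∀ (v : H) {φ : ℝ → ℝ} (hφ : Continuous φ) (hc : HasCompactSupport φ) (e : Vec d),
        inner ℝ v ((hmem' hφ hc e).toLp _) = inner ℝ (∫ t in Ioo (-1) T, φ t • v t) e := by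
      intro v φ hφ hc e
      have hi : Integrable (fun t => φ t • v t) (timeMeasure T) := by
        obtain ⟨C, hC⟩ := hφ.bounded_above_of_compact_support hc
        exact (integrable_timeMeasure v).bdd_smul C hφ.aestronglyMeasurable
          (Eventually.of_forall hC)
      rw [L2.inner_def, real_inner_comm, ← integral_inner hi e]
      refine integral_congr_ae ?_
      filter_upwards [(hmem' hφ hc e).coeFn_toLp] with t ht
      rw [ht, real_inner_smul_right, real_inner_smul_right, real_inner_comm]
    ext γ
    constructor
    · rintro ⟨v, hv, hw⟩
      refine ⟨(γ, ⟨StrongDual.toWeakDual (InnerProductSpace.toDual ℝ H v), ?_⟩), ?_, rfl⟩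
      · change InnerProductSpace.toDual ℝ H v ∈ Metric.closedBall 0 r
        simpa using hv
      · intro φ hφ hc hs e
        change _ = -(InnerProductSpace.toDual ℝ H v) _
        rw [InnerProductSpace.toDual_apply_apply, hpair v hφ.continuous hc e, hw φ hφ hc hs,
          inner_neg_left]
    · rintro ⟨⟨γ', ℓ⟩, hp, rfl⟩
      obtain ⟨v, hv⟩ := (InnerProductSpace.toDual ℝ H).surjective (WeakDual.toStrongDual ℓ.1)
      refine ⟨v, ?_, ?_⟩
      · have h1 : WeakDual.toStrongDual ℓ.1 ∈ Metric.closedBall 0 r := ℓ.2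
        rw [← hv] at h1
        simpa using h1
      · intro φ hφ hc hs
        refine ext_inner_right ℝ fun e => ?_
        rw [hp φ hφ hc hs e, inner_neg_left, ← hpair v hφ.continuous hc e,
          ← InnerProductSpace.toDual_apply_apply, hv]
        rfl
  rw [himg]
  exact isClosedMap_fst_of_compactSpace S hS

theorem lowerSemicontinuous_energy (d : ℕ) (T : ℝ) :
    LowerSemicontinuous (energy : Curves d T → ℝ≥0∞) := by
  rw [lowerSemicontinuous_iff_isClosed_preimage]
  intro y
  rcases eq_or_ne y ⊤ with rfl | hy
  · simp
  have e : (energy : Curves d T → ℝ≥0∞) ⁻¹' Iic y = Subtype.val ⁻¹'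
      {γ : Lp (Vec d) 2 (timeMeasure T) | ∃ v, ‖v‖ ≤ √y.toReal ∧ IsWeakDeriv γ v} := by
    ext γ
    have h := energy_le_ofReal_sq_iff (γ := γ) (Real.sqrt_nonneg y.toReal)
    rw [Real.sq_sqrt ENNReal.toReal_nonneg, ENNReal.ofReal_toReal hy] at h
    exact h
  rw [e]
  exact (isClosed_setOf_exists_isWeakDeriv d T _).preimage continuous_subtype_val

theorem norm_primitive_le (hT : 0 < T) (c : Vec d) (v : Lp (Vec d) 2 (timeMeasure T))
    {x : ℝ} (hx : x ∈ Icc (-1) T) :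
    ‖c + ∫ s in (0 : ℝ)..x, zeroExt v s‖ ≤ ‖c‖ + (T + 1) * ‖v‖ := by
  refine (norm_add_le _ _).trans (add_le_add le_rfl ?_)
  refine (norm_integral_zeroExt_sub_le v 0 x).trans ?_
  refine mul_le_mul_of_nonneg_right ?_ (norm_nonneg _)
  rw [Real.sqrt_le_left (by linarith)]
  have : |x - 0| ≤ T + 1 := by
    rw [abs_le]; constructor <;> linarith [hx.1, hx.2]
  nlinarith

/-- With a = ‖γ(0)‖ and b = ‖γ̇‖, the curve is bounded by a + (T+1) b; an interval of length T+1
then gives ‖γ‖ ≤ (T+1)² (a + b), and (a + b)² ≤ 2 (a² + b²) produces the constant. -/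
theorem enorm_sq_le_energy (hT : 0 < T) (γ : Curves d T) : ‖γ.1‖ₑ ^ 2 ≤
    ENNReal.ofReal (2 * (T + 1) ^ 4) * (‖initialLine γ 0‖ₑ ^ 2 + energy γ) := by
  rcases eq_or_ne (energy γ) ⊤ with h | h
  · rw [h, add_top, ENNReal.mul_top (by rw [Ne, ENNReal.ofReal_eq_zero]; push Not; positivity)]
    exact le_top
  obtain ⟨v, hv⟩ := exists_isWeakDeriv_of_energy_ne_top h
  rw [hv.energy_eq]
  have h1 : ‖γ.1‖ ≤ _ := Lp.norm_le_of_ae_bound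
    (C := ‖initialLine γ 0‖ + (T + 1) * ‖v‖) (by positivity) (by
      filter_upwards [hv.ae_eq hT, ae_restrict_mem measurableSet_Ioo] with t ht hm
      rw [ht]
      exact norm_primitive_le hT _ v (Ioo_subset_Icc_self hm))
  set a := ‖initialLine γ 0‖ with ha
  set b := ‖v‖ with hb
  have ha0 : 0 ≤ a := norm_nonneg _
  have hb0 : 0 ≤ b := norm_nonneg _
  have h2 : ((timeMeasure T).real univ) = T + 1 := by
    simp [Measure.real, ENNReal.toReal_ofReal (show 0 ≤ T + 1 by linarith)]
  have h3 : ‖γ.1‖ ≤ (T + 1) * (a + (T + 1) * b) := by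
    refine h1.trans (mul_le_mul_of_nonneg_right ?_ (by positivity))
    have h4 : ((measureUnivNNReal (timeMeasure T) : ℝ)) = T + 1 := h2
    have h5 : (1 : ℝ) ≤ T + 1 := by linarith
    rw [h4]
    calc (T + 1) ^ ((2 : ℝ≥0∞).toReal⁻¹) ≤ (T + 1) ^ (1 : ℝ) :=
          Real.rpow_le_rpow_of_exponent_le h5 (by norm_num)
      _ = T + 1 := Real.rpow_one _
  have h4 : ‖γ.1‖ ^ 2 ≤ 2 * (T + 1) ^ 4 * (a ^ 2 + b ^ 2) := by
    have h5 : (a + (T + 1) * b) ≤ (T + 1) * (a + b) := by nlinarith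
    have h6 : ‖γ.1‖ ≤ (T + 1) ^ 2 * (a + b) := by
      calc _ ≤ _ := h3
        _ ≤ (T + 1) * ((T + 1) * (a + b)) := by gcongr
        _ = _ := by ring
    calc ‖γ.1‖ ^ 2 ≤ ((T + 1) ^ 2 * (a + b)) ^ 2 := by gcongr
      _ = (T + 1) ^ 4 * (a + b) ^ 2 := by ring
      _ ≤ (T + 1) ^ 4 * (2 * (a ^ 2 + b ^ 2)) := by
          gcongr; nlinarith [sq_nonneg (a - b)]
      _ = _ := by ring
  have h5 := ENNReal.ofReal_le_ofReal h4
  rwa [ENNReal.ofReal_mul (by positivity), ENNReal.ofReal_add (by positivity) (by positivity),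
    ENNReal.ofReal_pow (norm_nonneg _), ENNReal.ofReal_pow ha0, ENNReal.ofReal_pow hb0,
    ofReal_norm, ha, ofReal_norm, hb, ofReal_norm] at h5

/-- Such curves are uniformly bounded and 1/2-Hölder with constant r, so Arzelà-Ascoli gives a
compact set of continuous functions, whose image in L² is compact; the set itself is closed in Γ. -/
theorem isCompact_energy_le (hT : 0 < T) {r : ℝ} (hr : 0 ≤ r) :
    IsCompact {γ : Curves d T | ‖initialLine γ 0‖ ≤ r ∧ energy γ ≤ ENNReal.ofReal (r ^ 2)} := by
  let J := Icc (-1 : ℝ) T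
  have hJ : (-1 : ℝ) ≤ T := by linarith
  let A : Set (BoundedContinuousFunction J (Vec d)) :=
    {f | (∀ x, f x ∈ Metric.closedBall 0 (r + (T + 1) * r)) ∧
      ∀ x y, dist (f x) (f y) ≤ √(dist x y) * r}
  have hA : IsCompact A := by
    refine BoundedContinuousFunction.arzela_ascoli₂ _ (isCompact_closedBall (0 : Vec d)
      (r + (T + 1) * r)) A ?_ (fun f x hf => hf.1 x) ?_
    · have : A = (⋂ x, {f | f x ∈ Metric.closedBall 0 (r + (T + 1) * r)}) ∩
          ⋂ x, ⋂ y, {f | dist (f x) (f y) ≤ √(dist x y) * r} := by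
        ext f; simp [A]
      rw [this]
      have hev : ∀ x : J, Continuous fun f : BoundedContinuousFunction J (Vec d) => f x :=
        fun x => (BoundedContinuousFunction.lipschitz_eval_const x).continuous
      exact (isClosed_iInter fun x => Metric.isClosed_closedBall.preimage (hev x)).inter
        (isClosed_iInter fun x => isClosed_iInter fun y =>
          isClosed_le ((hev x).dist (hev y)) continuous_const)
    · refine Metric.equicontinuous_of_continuity_modulus (fun s => √s * r) ?_ _
        fun x y f => f.2.2 x y
      have : Continuous fun s : ℝ => √s * r := by fun_prop
      simpa using this.tendsto 0
  -- Functions on [-1, T] are extended to ℝ by their endpoint values before passing to L².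
  let Φ : BoundedContinuousFunction J (Vec d) → Lp (Vec d) 2 (timeMeasure T) := fun f =>
    BoundedContinuousFunction.toLp 2 (timeMeasure T) ℝ
      (f.compContinuous ⟨projIcc (-1) T hJ, continuous_projIcc⟩)
  have hΦ : Continuous Φ := (BoundedContinuousFunction.toLp 2 (timeMeasure T) ℝ).continuous.comp
    (BoundedContinuousFunction.continuous_compContinuous _)
  have hcomp : IsCompact (Subtype.val ⁻¹' (Φ '' A) : Set (Curves d T)) :=
    (isClosed_isAffineBeforeZero d T).isClosedEmbedding_subtypeVal.isCompact_preimage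
      (hA.image hΦ)
  refine hcomp.of_isClosed_subset ?_ ?_
  · exact (isClosed_le (continuous_initialLine_zero hT).norm continuous_const).inter
      ((lowerSemicontinuous_iff_isClosed_preimage.1 (lowerSemicontinuous_energy d T)) _)
  · rintro γ ⟨h1, h2⟩
    obtain ⟨v, hv, hw⟩ := (energy_le_ofReal_sq_iff hr).1 h2
    have hcont : Continuous fun x => initialLine γ 0 + ∫ s in (0 : ℝ)..x, zeroExt v s :=
      continuous_const.add (intervalIntegral_zeroExt_continuous v)
    let f : BoundedContinuousFunction J (Vec d) := BoundedContinuousFunction.mkOfCompact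
      ⟨fun x : J => initialLine γ 0 + ∫ s in (0 : ℝ)..x, zeroExt v s,
        hcont.comp continuous_subtype_val⟩
    refine ⟨f, ⟨fun x => ?_, fun x y => ?_⟩, ?_⟩
    · rw [mem_closedBall_zero_iff]
      refine (norm_primitive_le hT _ v x.2).trans ?_
      gcongr
    · change dist (initialLine γ 0 + ∫ s in (0 : ℝ)..x, zeroExt v s)
        (initialLine γ 0 + ∫ s in (0 : ℝ)..y, zeroExt v s) ≤ _
      rw [dist_add_left, dist_eq_norm, intervalIntegral.integral_interval_sub_left
        (integrable_zeroExt v).intervalIntegrable (integrable_zeroExt v).intervalIntegrable]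
      refine (norm_integral_zeroExt_sub_le v y x).trans ?_
      rw [Subtype.dist_eq, Real.dist_eq]
      gcongr
    · apply Lp.ext
      filter_upwards [hw.ae_eq hT, ae_restrict_mem measurableSet_Ioo,
        BoundedContinuousFunction.coeFn_toLp (p := 2) (μ := timeMeasure T) (𝕜 := ℝ)
        (f.compContinuous ⟨projIcc (-1) T hJ, continuous_projIcc⟩)] with t h3 h4 h5
      rw [h3]
      refine h5.trans ?_
      change initialLine γ 0 + ∫ s in (0 : ℝ)..(projIcc (-1) T hJ t : ℝ), zeroExt v s = _
      rw [projIcc_of_mem hJ (Ioo_subset_Icc_self h4)]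

/-! ### Semicontinuity and continuity of integrals under narrow convergence. -/

section Narrow

variable {X : Type*} [TopologicalSpace X] [MeasurableSpace X] [BorelSpace X]

/-- Integrals of lower semicontinuous functions are lower semicontinuous under narrow
convergence. -/
theorem lintegral_le_liminf_of_lowerSemicontinuous [MetrizableSpace X] {f : X → ℝ≥0∞} (hf : LowerSemicontinuous f)
    {μ : ProbabilityMeasure X} {μs : ℕ → ProbabilityMeasure X} (h : Tendsto μs atTop (𝓝 μ)) :
    ∫⁻ x, f x ∂(μ : Measure X) ≤ liminf (fun n => ∫⁻ x, f x ∂(μs n : Measure X)) atTop := by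
  have hfm : Measurable f := hf.measurable
  have h1 : ∫⁻ x, f x ∂(μ : Measure X) = ⨆ n : ℕ, ∫⁻ x, min (f x) n ∂(μ : Measure X) := by
    rw [← lintegral_iSup (fun n => hfm.min measurable_const)
      (fun m n hmn x => min_le_min le_rfl (by exact_mod_cast hmn))]
    refine lintegral_congr fun x => ?_
    rw [← inf_iSup_eq, ENNReal.iSup_natCast, inf_top_eq]
  rw [h1]
  refine iSup_le fun n => ?_
  have hfin : ∀ x, min (f x) n ≠ ⊤ := fun x => ne_top_of_le_ne_top (by simp) (min_le_right _ _)
  -- Layer-cake formula for the truncation, whose values are finite. Superlevel sets are open, so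
  -- the portmanteau theorem applies for each t > 0, and Fatou's lemma in t concludes.
  have hlayer : ∀ ν : ProbabilityMeasure X, ∫⁻ x, min (f x) n ∂(ν : Measure X) =
      ∫⁻ t in Ioi (0 : ℝ), (ν : Measure X) {x | t < (min (f x) n).toReal} := fun ν => by
    rw [← lintegral_eq_lintegral_meas_lt _ (Eventually.of_forall fun x => ENNReal.toReal_nonneg)
      (hfm.min measurable_const).ennreal_toReal.aemeasurable]
    exact lintegral_congr fun x => (ENNReal.ofReal_toReal (hfin x)).symm
  calc ∫⁻ x, min (f x) n ∂(μ : Measure X)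
      = ∫⁻ t in Ioi (0 : ℝ), (μ : Measure X) {x | t < (min (f x) n).toReal} := hlayer μ
    _ ≤ ∫⁻ t in Ioi (0 : ℝ), liminf (fun i =>
          (μs i : Measure X) {x | t < (min (f x) n).toReal}) atTop := by
        refine setLIntegral_mono' measurableSet_Ioi fun t ht => ?_
        refine ProbabilityMeasure.le_liminf_measure_open_of_tendsto h ?_
        have : {x | t < (min (f x) n).toReal} = {x | ENNReal.ofReal t < f x} ∩
            {_x : X | ENNReal.ofReal t < n} := by
          ext x
          rw [mem_ofPred_eq, ← ENNReal.ofReal_lt_iff_lt_toReal (le_of_lt ht) (hfin x), lt_min_iff]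
          rfl
        rw [this]
        exact (hf.isOpen_preimage _).inter isOpen_const
    _ ≤ liminf (fun i => ∫⁻ t in Ioi (0 : ℝ),
          (μs i : Measure X) {x | t < (min (f x) n).toReal}) atTop :=
        lintegral_liminf_le fun i => Antitone.measurable fun s t hst =>
          measure_mono fun x hx => lt_of_le_of_lt hst hx
    _ ≤ liminf (fun n => ∫⁻ x, f x ∂(μs n : Measure X)) atTop := by
        refine liminf_le_liminf (Eventually.of_forall fun i => ?_)
        rw [← hlayer]
        exact lintegral_mono fun x => min_le_left _ _

theorem isClosed_setOf_lintegral_le [MetrizableSpace X] [SeparableSpace X] {f : X → ℝ≥0∞}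
    (hf : LowerSemicontinuous f) (c : ℝ≥0∞) :
    IsClosed {μ : ProbabilityMeasure X | ∫⁻ x, f x ∂(μ : Measure X) ≤ c} := by
  refine IsSeqClosed.isClosed fun μs μ hμs h => ?_
  refine (lintegral_le_liminf_of_lowerSemicontinuous hf h).trans ?_
  exact (liminf_le_liminf (Eventually.of_forall hμs)).trans (by simp)

/-- The error of truncation is controlled by the second moment, which yields uniformity over
measures below. -/
theorem abs_sub_truncation_le (x : ℝ) {r : ℝ} (hr : 0 < r) :
    |x - max (-r) (min r x)| ≤ x ^ 2 / r := by
  rw [le_div_iff₀ hr]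
  rcases le_total r x with h | h
  · rw [min_eq_left h, max_eq_right (by linarith), abs_of_nonneg (by linarith)]
    nlinarith
  · rw [min_eq_right h]
    rcases le_total (-r) x with h' | h'
    · rw [max_eq_right h', sub_self, abs_zero, zero_mul]; positivity
    · rw [max_eq_left h', abs_of_nonpos (by linarith)]
      nlinarith

/-- Integrals of continuous functions are narrowly continuous on sets of measures on which their
second moments are bounded. -/
theorem continuousOn_integral_of_lintegral_sq_le {G : X → ℝ} (hG : Continuous G)
    {C : ℝ≥0∞} (hC : C ≠ ⊤) :
    ContinuousOn (fun μ : ProbabilityMeasure X => ∫ x, G x ∂(μ : Measure X))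
      {μ | ∫⁻ x, ‖G x‖ₑ ^ 2 ∂(μ : Measure X) ≤ C} := by
  let F : ℕ → BoundedContinuousFunction X ℝ := fun n =>
    BoundedContinuousFunction.ofNormedAddCommGroup (fun x => max (-(n + 1 : ℝ)) (min (n + 1) (G x)))
      (by fun_prop) (n + 1) fun x => by
        rw [Real.norm_eq_abs, abs_le]
        have : (0 : ℝ) ≤ n := n.cast_nonneg
        exact ⟨le_max_left _ _, max_le (by linarith) (min_le_left _ _)⟩
  -- Truncated integrals are narrowly continuous and differ from the full one by at most C / (n +
  -- 1), so the latter is a uniform limit of continuous functions.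
  have hunif : TendstoUniformlyOn (fun (n : ℕ) (μ : ProbabilityMeasure X) =>
      ∫ x, F n x ∂(μ : Measure X)) (fun μ => ∫ x, G x ∂(μ : Measure X)) atTop
      {μ | ∫⁻ x, ‖G x‖ₑ ^ 2 ∂(μ : Measure X) ≤ C} := by
    rw [Metric.tendstoUniformlyOn_iff]
    intro ε hε
    obtain ⟨N, hN⟩ := exists_nat_gt (C.toReal / ε)
    filter_upwards [eventually_ge_atTop N] with n hn μ hμ
    have hmem : MemLp G 2 (μ : Measure X) := by
      refine ⟨hG.aestronglyMeasurable, ?_⟩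
      rw [eLpNorm_lt_top_iff_lintegral_rpow_enorm_lt_top (by norm_num) (by norm_num)]
      refine lt_of_le_of_lt ?_ (lt_of_le_of_lt hμ hC.lt_top)
      simp
    have hGi : Integrable G (μ : Measure X) := hmem.integrable (by norm_num)
    have hG2 : Integrable (fun x => G x ^ 2) (μ : Measure X) := hmem.integrable_sq
    have h2 : ∫ x, G x ^ 2 ∂(μ : Measure X) ≤ C.toReal := by
      rw [integral_eq_lintegral_of_nonneg_ae (Eventually.of_forall fun x => sq_nonneg _)
        hG2.aestronglyMeasurable]
      refine ENNReal.toReal_mono hC (le_of_eq_of_le (lintegral_congr fun x => ?_) hμ)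
      rw [← ofReal_norm, ← ENNReal.ofReal_pow (norm_nonneg _), Real.norm_eq_abs, sq_abs]
    have hpos : (0 : ℝ) < n + 1 := by positivity
    rw [dist_eq_norm, ← integral_sub hGi ((F n).integrable _)]
    calc ‖∫ x, (G x - F n x) ∂(μ : Measure X)‖
        ≤ ∫ x, G x ^ 2 / (n + 1) ∂(μ : Measure X) :=
          norm_integral_le_of_norm_le (hG2.div_const _)
            (Eventually.of_forall fun x => abs_sub_truncation_le (G x) hpos)
      _ = (∫ x, G x ^ 2 ∂(μ : Measure X)) / (n + 1) := integral_div _ _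
      _ ≤ C.toReal / (n + 1) := by gcongr
      _ < ε := by
          rw [div_lt_iff₀ hpos]
          rw [div_lt_iff₀ hε] at hN
          have : (N : ℝ) ≤ n := by exact_mod_cast hn
          nlinarith
  refine hunif.continuousOn (Frequently.of_forall fun n => ?_)
  exact (ProbabilityMeasure.continuous_integral_boundedContinuousFunction (F n)).continuousOn

end Narrow

/-! ### Compactness of the admissible measures. -/

theorem isClosed_admissible (hT : 0 < T) : IsClosed (admissible d T) := by
  refine (isClosed_setOf_lintegral_le (f := fun γ : Curves d T => ‖initialLine γ 0‖ₑ ^ 2)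
    ?_ 1).inter (isClosed_setOf_lintegral_le (lowerSemicontinuous_energy d T) 1)
  exact ((ENNReal.continuous_pow 2).comp
    (continuous_initialLine_zero hT).enorm).lowerSemicontinuous

/-- Prokhorov's theorem: outside the compact set where |γ(0)|² and the energy are at most n, one of
the two is at least n, and Markov's inequality gives mass at most 1/n to each event. -/
theorem isCompact_admissible (hT : 0 < T) : IsCompact (admissible d T) := by
  rw [← (isClosed_admissible hT).closure_eq]
  refine isCompact_closure_of_isTightMeasureSet ?_
  rw [isTightMeasureSet_iff_exists_isCompact_measure_compl_le]
  intro ε hε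
  obtain ⟨n, hn⟩ := ENNReal.exists_inv_nat_lt (show ε / 2 ≠ 0 by simpa using hε.ne')
  have hn0 : n ≠ 0 := by rintro rfl; simp at hn
  have hnpos : (n : ℝ≥0∞) ≠ 0 := by exact_mod_cast hn0
  refine ⟨_, isCompact_energy_le (d := d) hT (Real.sqrt_nonneg n), ?_⟩
  rintro _ ⟨η, ⟨h1, h2⟩, rfl⟩
  rw [Real.sq_sqrt n.cast_nonneg, ENNReal.ofReal_natCast]
  have hsub : {γ : Curves d T | ‖initialLine γ 0‖ ≤ √n ∧ energy γ ≤ n}ᶜ ⊆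
      {γ | (n : ℝ≥0∞) ≤ ‖initialLine γ 0‖ₑ ^ 2} ∪ {γ | (n : ℝ≥0∞) ≤ energy γ} := by
    intro γ hγ
    rw [mem_compl_iff, mem_ofPred_eq, not_and_or, not_le, not_le] at hγ
    refine hγ.imp (fun h => ?_) le_of_lt
    rw [mem_ofPred_eq, ← ofReal_norm, ← ENNReal.ofReal_pow (norm_nonneg _),
      ← ENNReal.ofReal_natCast]
    refine ENNReal.ofReal_le_ofReal ?_
    rw [← Real.sq_sqrt (n.cast_nonneg : (0 : ℝ) ≤ n)]
    gcongr
  have hmark : ∀ f : Curves d T → ℝ≥0∞, Measurable f → ∫⁻ γ, f γ ∂(η : Measure (Curves d T)) ≤ 1 →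
      (η : Measure (Curves d T)) {γ | (n : ℝ≥0∞) ≤ f γ} ≤ ε / 2 := fun f hf h => by
    refine (meas_ge_le_lintegral_div hf.aemeasurable hnpos (by simp)).trans ?_
    refine (ENNReal.div_le_div_right h _).trans ?_
    rw [one_div]
    exact hn.le
  calc _ ≤ _ := measure_mono hsub
    _ ≤ _ := measure_union_le _ _
    _ ≤ ε / 2 + ε / 2 := add_le_add
        (hmark _ ((continuous_initialLine_zero hT).measurable.enorm.pow_const 2) h1)
        (hmark _ (lowerSemicontinuous_energy d T).measurable h2)
    _ = ε := ENNReal.add_halves ε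

theorem lintegral_enorm_sq_le_of_admissible (hT : 0 < T) {η : ProbabilityMeasure (Curves d T)}
    (hη : η ∈ admissible d T) : ∫⁻ γ, ‖γ.1‖ₑ ^ 2 ∂(η : Measure (Curves d T)) ≤
      ENNReal.ofReal (2 * (T + 1) ^ 4) * 2 := by
  refine (lintegral_mono (enorm_sq_le_energy hT)).trans ?_
  rw [lintegral_const_mul' _ _ ENNReal.ofReal_ne_top, lintegral_add_left
    ((continuous_initialLine_zero hT).measurable.enorm.pow_const 2)]
  gcongr
  exact (add_le_add hη.1 hη.2).trans_eq one_add_one_eq_two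

/-! ### The balance condition and its closedness. -/

/-- A linear functional of the part of `γ` after time `s`. -/
def phase (s : ℝ) (g : Lp (Vec d) 2 (timeMeasure T)) (γ : Curves d T) : ℝ :=
  ∫ t in Ioo s T, inner ℝ (g t) (γ.1 t) ∂(timeMeasure T)

theorem phase_eq_inner (s : ℝ) (g : Lp (Vec d) 2 (timeMeasure T)) (γ : Curves d T) :
    phase s g γ =
      inner ℝ (LpToLpRestrictCLM ℝ (Vec d) ℝ (timeMeasure T) 2 (Ioo s T) g) (tail s γ) := by
  rw [L2.inner_def]
  refine integral_congr_ae ?_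
  filter_upwards [LpToLpRestrictCLM_coeFn ℝ (Ioo s T) g,
    LpToLpRestrictCLM_coeFn ℝ (Ioo s T) γ.1] with t h1 h2
  rw [h1, tail, h2]

theorem continuous_tail (s : ℝ) : Continuous (tail s : Curves d T → TailCurves d T s) :=
  (ContinuousLinearMap.continuous _).comp continuous_subtype_val

theorem continuous_phase (s : ℝ) (g : Lp (Vec d) 2 (timeMeasure T)) :
    Continuous (phase s g : Curves d T → ℝ) := by
  have : (phase s g : Curves d T → ℝ) = _ := funext (phase_eq_inner s g)
  rw [this]
  exact continuous_const.inner (continuous_tail s)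

/-- The integral of `χ (W₀ - γ̇)`, for a test function `χ`. -/
def defect (χ : ℝ → ℝ) (γ : Curves d T) : Vec d :=
  (∫ t in Ioo (-1) T, deriv χ t • γ.1 t) + (∫ t, χ t) • W₀ γ

theorem continuous_defect (hT : 0 < T) {χ : ℝ → ℝ} (hχ : ContDiff ℝ ∞ χ)
    (hc : HasCompactSupport χ) : Continuous (defect χ : Curves d T → Vec d) :=
  ((continuous_integral_smul ((hχ.continuous_deriv (by simp)).memLp_of_hasCompactSupport
    hc.deriv)).comp continuous_subtype_val).add ((continuous_W₀ hT).fun_const_smul _)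

theorem exists_norm_defect_le (hT : 0 < T) {χ : ℝ → ℝ} (hχ : ContDiff ℝ ∞ χ)
    (hc : HasCompactSupport χ) : ∃ C : ℝ, ∀ γ : Curves d T, ‖defect χ γ‖ ≤ C * ‖γ.1‖ := by
  have hb : ∀ k : ℝ → ℝ, MemLp k 2 (timeMeasure T) → ∃ C : ℝ, ∀ γ : Lp (Vec d) 2 (timeMeasure T),
      ‖∫ t, k t • γ t ∂(timeMeasure T)‖ ≤ C * ‖γ‖ := fun k hk => by
    refine ⟨‖(ContinuousLinearMap.lsmul ℝ ℝ : ℝ →L[ℝ] Vec d →L[ℝ] Vec d).lpPairing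
      (timeMeasure T) 2 2 (hk.toLp k)‖, fun γ => ?_⟩
    have h := ((ContinuousLinearMap.lsmul ℝ ℝ : ℝ →L[ℝ] Vec d →L[ℝ] Vec d).lpPairing
      (timeMeasure T) 2 2 (hk.toLp k)).le_opNorm γ
    rw [ContinuousLinearMap.lpPairing_eq_integral] at h
    refine le_of_eq_of_le (congrArg norm (integral_congr_ae ?_)) h
    filter_upwards [hk.coeFn_toLp] with t ht
    simp [ht]
  obtain ⟨C₁, h₁⟩ := hb _ ((hχ.continuous_deriv (by simp)).memLp_of_hasCompactSupport hc.deriv)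
  obtain ⟨C₂, h₂⟩ := hb _ (memLp_indicator_poly T 12 6)
  refine ⟨C₁ + ‖∫ t, χ t‖ * C₂, fun γ => ?_⟩
  have h3 := h₂ γ.1
  rw [← W₀_eq_integral hT] at h3
  calc ‖defect χ γ‖ ≤ ‖∫ t in Ioo (-1) T, deriv χ t • γ.1 t‖ + ‖(∫ t, χ t) • W₀ γ‖ :=
        norm_add_le _ _
    _ ≤ C₁ * ‖γ.1‖ + ‖∫ t, χ t‖ * (C₂ * ‖γ.1‖) := by
        rw [norm_smul]
        exact add_le_add (h₁ γ.1) (mul_le_mul_of_nonneg_left h3 (norm_nonneg _))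
    _ = _ := by ring

/-- The weak form of the condition that the velocity is the conditional expectation of the
initial velocity given the future of the curve. -/
def IsBalanced (η : ProbabilityMeasure (Curves d T)) : Prop :=
  ∀ (s : ℝ) (χ : ℝ → ℝ) (g : Lp (Vec d) 2 (timeMeasure T)) (f : ℝ → ℝ) (e : Vec d),
    s ∈ Ioo 0 T → ContDiff ℝ ∞ χ → HasCompactSupport χ → tsupport χ ⊆ Ioo 0 s →
    Continuous f → (∀ x, |f x| ≤ 1) →
    ∫ γ, f (phase s g γ) * inner ℝ (defect χ γ) e ∂(η : Measure (Curves d T)) = 0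

/-- Each balance condition is the vanishing of the integral of a continuous function of at most
linear growth in ‖γ‖, and second moments are uniformly bounded on admissible measures. -/
theorem isCompact_setOf_isBalanced (hT : 0 < T) :
    IsCompact {η : ProbabilityMeasure (Curves d T) | η ∈ admissible d T ∧ IsBalanced η} := by
  -- Each condition is intersected with `admissible d T` separately, because continuity of its
  -- integral is available only on that closed set.
  have hcl : {η : ProbabilityMeasure (Curves d T) | η ∈ admissible d T ∧ IsBalanced η} =
      admissible d T ∩ ⋂ (s : ℝ) (χ : ℝ → ℝ) (g : Lp (Vec d) 2 (timeMeasure T)) (f : ℝ → ℝ)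
        (e : Vec d) (_ : s ∈ Ioo 0 T) (_ : ContDiff ℝ ∞ χ) (_ : HasCompactSupport χ)
        (_ : tsupport χ ⊆ Ioo 0 s) (_ : Continuous f) (_ : ∀ x, |f x| ≤ 1),
        admissible d T ∩ {η | ∫ γ, f (phase s g γ) * inner ℝ (defect χ γ) e
          ∂(η : Measure (Curves d T)) = 0} := by
    ext η
    simp only [mem_inter_iff, mem_iInter, mem_ofPred_eq, IsBalanced]
    constructor
    · exact fun h => ⟨h.1, fun s χ g f e a1 a2 a3 a4 a5 a6 =>
        ⟨h.1, h.2 s χ g f e a1 a2 a3 a4 a5 a6⟩⟩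
    · exact fun h => ⟨h.1, fun s χ g f e a1 a2 a3 a4 a5 a6 =>
        (h.2 s χ g f e a1 a2 a3 a4 a5 a6).2⟩
  rw [hcl]
  refine (isCompact_admissible hT).inter_right ?_
  refine isClosed_iInter fun s => isClosed_iInter fun χ => isClosed_iInter fun g =>
    isClosed_iInter fun f => isClosed_iInter fun e => isClosed_iInter fun _ =>
    isClosed_iInter fun hχ => isClosed_iInter fun hc => isClosed_iInter fun _ =>
    isClosed_iInter fun hf => isClosed_iInter fun hf1 => ?_
  obtain ⟨C, hC⟩ := exists_norm_defect_le (d := d) hT hχ hc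
  have hG : Continuous fun γ : Curves d T => f (phase s g γ) * inner ℝ (defect χ γ) e :=
    (hf.comp (continuous_phase s g)).mul ((continuous_defect hT hχ hc).inner continuous_const)
  let D : ℝ≥0∞ := ENNReal.ofReal ((C * ‖e‖) ^ 2) * (ENNReal.ofReal (2 * (T + 1) ^ 4) * 2)
  have hD : D ≠ ⊤ := by
    simp only [D]
    finiteness
  have hsub : admissible d T ⊆ {η : ProbabilityMeasure (Curves d T) |
      ∫⁻ γ, ‖f (phase s g γ) * inner ℝ (defect χ γ) e‖ₑ ^ 2 ∂(η : Measure (Curves d T)) ≤ D} :=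
    fun η hη => by
      refine le_trans ?_ (mul_le_mul_right (lintegral_enorm_sq_le_of_admissible hT hη) _)
      rw [← lintegral_const_mul' _ _ ENNReal.ofReal_ne_top]
      refine lintegral_mono fun γ => ?_
      have hle : ‖f (phase s g γ) * inner ℝ (defect χ γ) e‖ ≤ C * ‖e‖ * ‖γ.1‖ := by
        rw [norm_mul]
        calc _ ≤ 1 * (‖defect χ γ‖ * ‖e‖) :=
              mul_le_mul (hf1 _) (norm_inner_le_norm _ _) (norm_nonneg _) zero_le_one
          _ ≤ 1 * (C * ‖γ.1‖ * ‖e‖) := by gcongr; exact hC γ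
          _ = _ := by ring
      rw [← ofReal_norm, ← ofReal_norm, ← ENNReal.ofReal_pow (norm_nonneg _),
        ← ENNReal.ofReal_pow (norm_nonneg _), ← ENNReal.ofReal_mul (sq_nonneg _), ← mul_pow]
      refine ENNReal.ofReal_le_ofReal ?_
      gcongr
  exact ((continuousOn_integral_of_lintegral_sq_le hG hD).mono hsub).preimage_isClosed_of_isClosed (isClosed_admissible hT) isClosed_singleton

/-! ### Dissipative solutions are balanced. -/

theorem restrict_Icc_le_timeMeasure (T : ℝ) : volume.restrict (Icc 0 T) ≤ timeMeasure T := by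
  rw [← Measure.restrict_congr_set (Ioo_ae_eq_Icc (μ := volume) (a := (0 : ℝ)) (b := T))]
  exact Measure.restrict_mono (Ioo_subset_Ioo_left (by norm_num)) le_rfl

theorem enorm_sq_eq_lintegral {α : Type*} {m : MeasurableSpace α} {μ : Measure α}
    (v : Lp (Vec d) 2 μ) : ‖v‖ₑ ^ 2 = ∫⁻ t, ‖v t‖ₑ ^ 2 ∂μ := by
  have h := eLpNorm_nnreal_pow_eq_lintegral (f := v) (μ := μ) (p := 2) (by norm_num)
  rw [Lp.enorm_def]
  simpa using h

theorem memLp_two_of_lintegral_sq {α E : Type*} {m : MeasurableSpace α} {μ : Measure α}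
    [NormedAddCommGroup E] {f : α → E} (hf : AEStronglyMeasurable f μ)
    (h : ∫⁻ x, ‖f x‖ₑ ^ 2 ∂μ ≠ ⊤) : MemLp f 2 μ := by
  refine ⟨hf, ?_⟩
  rw [eLpNorm_lt_top_iff_lintegral_rpow_enorm_lt_top (by norm_num) (by norm_num)]
  simpa using h.lt_top

theorem integrable_W₀ (hT : 0 < T) {η : ProbabilityMeasure (Curves d T)}
    (hη : η ∈ admissible d T) : Integrable W₀ (η : Measure (Curves d T)) := by
  have h1 : MemLp (fun γ : Curves d T => ‖γ.1‖) 2 (η : Measure (Curves d T)) := by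
    refine memLp_two_of_lintegral_sq continuous_subtype_val.norm.aestronglyMeasurable ?_
    simp only [enorm_norm]
    exact ne_top_of_le_ne_top (ENNReal.mul_ne_top ENNReal.ofReal_ne_top (by simp))
      (lintegral_enorm_sq_le_of_admissible hT hη)
  have h2 : Integrable (fun γ : Curves d T => ‖γ.1‖) (η : Measure (Curves d T)) :=
    h1.integrable (by norm_num)
  have hk := memLp_indicator_poly T 12 6
  let L := (ContinuousLinearMap.lsmul ℝ ℝ : ℝ →L[ℝ] Vec d →L[ℝ] Vec d).lpPairing
      (timeMeasure T) 2 2 (hk.toLp _)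
  refine (h2.const_mul ‖L‖).mono' (continuous_W₀ hT).aestronglyMeasurable
    (Eventually.of_forall fun γ => ?_)
  refine le_of_eq_of_le (congrArg norm ?_) (L.le_opNorm γ.1)
  rw [W₀_eq_integral hT, ContinuousLinearMap.lpPairing_eq_integral]
  refine integral_congr_ae ?_
  filter_upwards [hk.coeFn_toLp] with t ht
  simp [ht]

theorem ae_energy_ne_top {η : ProbabilityMeasure (Curves d T)} (hη : η ∈ admissible d T) :
    ∀ᵐ γ ∂(η : Measure (Curves d T)), energy γ ≠ ⊤ := by
  filter_upwards [ae_lt_top (lowerSemicontinuous_energy d T).measurable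
    (ne_top_of_le_ne_top (by simp) hη.2)] with γ h using h.ne

/-- A jointly measurable version of the velocity is almost surely the weak derivative. -/
theorem ae_exists_isWeakDeriv_ae_eq (hT : 0 < T) {η : ProbabilityMeasure (Curves d T)}
    (hη : η ∈ admissible d T) {V : ℝ × Curves d T → Vec d}
    (hV : ∀ᵐ p ∂((volume.restrict (Icc 0 T)).prod (η : Measure (Curves d T))),
      velocity p.2 p.1 = V p) :
    ∀ᵐ γ ∂(η : Measure (Curves d T)), ∃ v, IsWeakDeriv γ.1 v ∧
      ∀ᵐ t ∂(volume.restrict (Icc 0 T)), V (t, γ) = v t := by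
  have h1 := Measure.ae_ae_of_ae_prod
    (Measure.measurePreserving_swap.quasiMeasurePreserving.ae hV)
  filter_upwards [h1, ae_energy_ne_top hη] with γ h2 h3
  obtain ⟨v, hv⟩ := exists_isWeakDeriv_of_energy_ne_top h3
  refine ⟨v, hv, ?_⟩
  filter_upwards [h2, (restrict_Icc_le_timeMeasure T).absolutelyContinuous.ae_le
    (hv.ae_hasDerivAt hT)] with t h4 h5
  exact h4.symm.trans h5.deriv

/-- By Tonelli the energy bound makes V square integrable for the finite product measure. -/
theorem integrable_velocity (hT : 0 < T) {η : ProbabilityMeasure (Curves d T)}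
    (hη : η ∈ admissible d T) {V : ℝ × Curves d T → Vec d} (hVm : Measurable V)
    (hV : ∀ᵐ p ∂((volume.restrict (Icc 0 T)).prod (η : Measure (Curves d T))),
      velocity p.2 p.1 = V p) :
    Integrable V ((volume.restrict (Icc 0 T)).prod (η : Measure (Curves d T))) := by
  have h : MemLp V 2 ((volume.restrict (Icc 0 T)).prod (η : Measure (Curves d T))) := by
    refine memLp_two_of_lintegral_sq hVm.aestronglyMeasurable ?_
    rw [lintegral_prod_symm' _ (hVm.enorm.pow_const 2)]
    refine ne_top_of_le_ne_top ENNReal.one_ne_top (le_trans (lintegral_mono_ae ?_) hη.2)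
    filter_upwards [ae_exists_isWeakDeriv_ae_eq hT hη hV] with γ ⟨v, hv, hvV⟩
    rw [hv.energy_eq, enorm_sq_eq_lintegral]
    calc ∫⁻ t in Icc 0 T, ‖V (t, γ)‖ₑ ^ 2 = ∫⁻ t in Icc 0 T, ‖v t‖ₑ ^ 2 :=
          lintegral_congr_ae (hvV.mono fun t ht => by simp only [ht])
      _ ≤ _ := lintegral_mono' (restrict_Icc_le_timeMeasure T) le_rfl
  exact h.integrable (by norm_num)

theorem integrable_inner_W₀_sub (hT : 0 < T) {η : ProbabilityMeasure (Curves d T)}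
    (hη : η ∈ admissible d T) {V : ℝ × Curves d T → Vec d} (hVm : Measurable V)
    (hV : ∀ᵐ p ∂((volume.restrict (Icc 0 T)).prod (η : Measure (Curves d T))),
      velocity p.2 p.1 = V p) {φ : Curves d T → ℝ} (hφ : Continuous φ) (hφ1 : ∀ γ, |φ γ| ≤ 1)
    (e : Vec d) :
    Integrable (fun p : ℝ × Curves d T => φ p.2 * inner ℝ (W₀ p.2 - V p) e)
      ((volume.restrict (Icc 0 T)).prod (η : Measure (Curves d T))) := by
  have h1 : Integrable (fun p : ℝ × Curves d T => W₀ p.2 - V p)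
      ((volume.restrict (Icc 0 T)).prod (η : Measure (Curves d T))) :=
    ((integrable_W₀ hT hη).comp_snd _).sub (integrable_velocity hT hη hVm hV)
  exact (h1.inner_const e).bdd_mul
    (hφ.comp continuous_snd).aestronglyMeasurable (Eventually.of_forall fun p => hφ1 p.2)

/-- Disintegration in time of the weak balance condition. -/
theorem integral_mul_inner_defect (hT : 0 < T) {η : ProbabilityMeasure (Curves d T)}
    (hη : η ∈ admissible d T) {V : ℝ × Curves d T → Vec d} (hVm : Measurable V)
    (hV : ∀ᵐ p ∂((volume.restrict (Icc 0 T)).prod (η : Measure (Curves d T))),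
      velocity p.2 p.1 = V p) {φ : Curves d T → ℝ} (hφ : Continuous φ) (hφ1 : ∀ γ, |φ γ| ≤ 1)
    {χ : ℝ → ℝ} (hχ : ContDiff ℝ ∞ χ) (hc : HasCompactSupport χ) (hs : tsupport χ ⊆ Ioo 0 T)
    (e : Vec d) :
    ∫ γ, φ γ * inner ℝ (defect χ γ) e ∂(η : Measure (Curves d T)) =
      ∫ t in Icc 0 T, χ t *
        ∫ γ, φ γ * inner ℝ (W₀ γ - V (t, γ)) e ∂(η : Measure (Curves d T)) := by
  obtain ⟨C, hC⟩ := hχ.continuous.bounded_above_of_compact_support hc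
  have hint := (integrable_inner_W₀_sub hT hη hVm hV hφ hφ1 e).bdd_mul
    (f := fun p : ℝ × Curves d T => χ p.1)
    (hχ.continuous.comp continuous_fst).aestronglyMeasurable (Eventually.of_forall fun p => hC p.1)
  simp_rw [← integral_const_mul]
  rw [integral_integral_swap hint]
  refine integral_congr_ae ?_
  filter_upwards [ae_exists_isWeakDeriv_ae_eq hT hη hV] with γ ⟨v, hv, hvV⟩
  have hsI : tsupport χ ⊆ Icc 0 T := hs.trans Ioo_subset_Icc_self
  have hsJ : tsupport χ ⊆ Ioo (-1) T := hs.trans (Ioo_subset_Ioo_left (by norm_num))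
  have hvi : Integrable (fun t => χ t • v t) (volume.restrict (Icc 0 T)) :=
    ((integrable_timeMeasure v).mono_measure (restrict_Icc_le_timeMeasure T)).bdd_smul C
      hχ.continuous.aestronglyMeasurable (Eventually.of_forall hC)
  have hχi : Integrable χ (volume.restrict (Icc 0 T)) :=
    (hχ.continuous.integrable_of_hasCompactSupport hc).integrableOn
  -- This is the definition of the weak derivative tested with χ, whose support lies in (0, T).
  have h1 : defect χ γ = ∫ t in Icc 0 T, χ t • (W₀ γ - v t) := by
    simp only [smul_sub]
    rw [integral_sub (hχi.smul_const _) hvi, integral_smul_const,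
      integral_smul_eq_of_tsupport_subset hsI, defect, hv χ hχ hc hsJ,
      integral_smul_eq_of_tsupport_subset hsJ]
    have := integral_smul_eq_of_tsupport_subset hsI (fun _ => (1 : ℝ))
    simp only [smul_eq_mul, mul_one] at this
    rw [this]
    abel
  have hi : Integrable (fun t => χ t • (W₀ γ - v t)) (volume.restrict (Icc 0 T)) := by
    simp only [smul_sub]
    exact (hχi.smul_const _).sub hvi
  rw [h1, real_inner_comm, ← integral_inner hi, ← integral_const_mul]
  refine integral_congr_ae ?_
  filter_upwards [hvV] with t ht
  rw [ht, real_inner_smul_right, real_inner_comm]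
  ring

/-- The future of a curve after a later time is a function of its future. -/
theorem measurable_comap_tail {s t : ℝ} (hst : t ≤ s) :
    Measurable[MeasurableSpace.comap (tail t : Curves d T → _) inferInstance]
      (tail s : Curves d T → TailCurves d T s) := by
  have hle : (timeMeasure T).restrict (Ioo s T) ≤ (timeMeasure T).restrict (Ioo t T) :=
    Measure.restrict_mono (Ioo_subset_Ioo_left hst) le_rfl
  let Ψ : TailCurves d T t → TailCurves d T s := fun γ => ((Lp.memLp γ).mono_measure hle).toLp γ
  have hΨ : LipschitzWith 1 Ψ := LipschitzWith.of_edist_le fun x y => by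
    rw [Lp.edist_toLp_toLp, Lp.edist_def]
    exact eLpNorm_mono_measure _ hle
  have e : (tail s : Curves d T → TailCurves d T s) = Ψ ∘ tail t := by
    ext1 γ
    apply Lp.ext
    filter_upwards [((Lp.memLp (tail t γ)).mono_measure hle).coeFn_toLp,
      LpToLpRestrictCLM_coeFn ℝ (Ioo s T) γ.1,
      hle.absolutelyContinuous.ae_le (LpToLpRestrictCLM_coeFn ℝ (Ioo t T) γ.1)] with τ h1 h2 h3
    rw [tail, h2]
    refine Eq.symm (h1.trans ?_)
    rw [tail, h3]
  rw [e]
  exact hΨ.continuous.measurable.comp (comap_measurable _)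

theorem measurable_phase_comap_tail {s t : ℝ} (hst : t ≤ s)
    (g : Lp (Vec d) 2 (timeMeasure T)) :
    Measurable[MeasurableSpace.comap (tail t : Curves d T → _) inferInstance]
      (phase s g : Curves d T → ℝ) := by
  have e : (phase s g : Curves d T → ℝ) = (fun y => inner ℝ
      (LpToLpRestrictCLM ℝ (Vec d) ℝ (timeMeasure T) 2 (Ioo s T) g) y) ∘ tail s :=
    funext (phase_eq_inner s g)
  rw [e]
  exact (continuous_const.inner continuous_id).measurable.comp (measurable_comap_tail hst)

theorem comap_tail_le (t : ℝ) :
    MeasurableSpace.comap (tail t : Curves d T → _) inferInstance ≤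
      (inferInstance : MeasurableSpace (Curves d T)) :=
  (continuous_tail t).measurable.comap_le

/-- Passes from the disintegration to conditional expectation, the only form in which V_t is used
afterwards. -/
theorem averageVelocity_ae_eq (hT : 0 < T) {η : ProbabilityMeasure (Curves d T)}
    (hη : η ∈ admissible d T) (t : ℝ) :
    (η : Measure (Curves d T))[W₀ | MeasurableSpace.comap (tail t) inferInstance]
      =ᵐ[(η : Measure (Curves d T))] averageVelocity η t :=
  condExp_ae_eq_integral_condDistrib_id (continuous_tail t).measurable (integrable_W₀ hT hη)

theorem integral_mul_inner_sub_condExp {Ω : Type*} {m m0 : MeasurableSpace Ω} {μ : Measure Ω}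
    [IsFiniteMeasure μ] (hm : m ≤ m0) {W : Ω → Vec d} (hW : Integrable W μ) {φ : Ω → ℝ}
    (hφ : Measurable[m] φ) (hφ1 : ∀ x, |φ x| ≤ 1) (e : Vec d) :
    ∫ x, φ x * inner ℝ (W x - (μ[W | m]) x) e ∂μ = 0 := by
  have hφm := (hφ.mono hm le_rfl).aestronglyMeasurable (μ := μ)
  have hφW : Integrable (fun x => φ x • W x) μ :=
    hW.bdd_smul 1 hφm (Eventually.of_forall hφ1)
  have hφE : Integrable (fun x => φ x • (μ[W | m]) x) μ :=
    integrable_condExp.bdd_smul 1 hφm (Eventually.of_forall hφ1)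
  have h1 : ∫ x, φ x • (μ[W | m]) x ∂μ = ∫ x, φ x • W x ∂μ := by
    rw [← integral_condExp hm (f := fun x => φ x • W x)]
    exact integral_congr_ae (condExp_smul_of_aestronglyMeasurable_left
      hφ.stronglyMeasurable.aestronglyMeasurable hφW hW).symm
  have h2 : ∀ x, φ x * inner ℝ (W x - (μ[W | m]) x) e =
      inner ℝ e (φ x • W x - φ x • (μ[W | m]) x) := fun x => by
    rw [← smul_sub, real_inner_smul_right, real_inner_comm]
  simp_rw [h2]
  have h3 : Integrable (fun x => φ x • W x - φ x • (μ[W | m]) x) μ := hφW.sub hφE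
  rw [integral_inner h3, integral_sub hφW hφE, h1, sub_self, inner_zero_right]

theorem integral_mul_inner_W₀_sub_eq_zero (hT : 0 < T) {η : ProbabilityMeasure (Curves d T)}
    (hη : η ∈ admissible d T) {t : ℝ} {φ : Curves d T → ℝ}
    (hφ : Measurable[MeasurableSpace.comap (tail t) inferInstance] φ) (hφ1 : ∀ γ, |φ γ| ≤ 1)
    {U : Curves d T → Vec d} (hU : ∀ᵐ γ ∂(η : Measure (Curves d T)), U γ = averageVelocity η t γ)
    (e : Vec d) :
    ∫ γ, φ γ * inner ℝ (W₀ γ - U γ) e ∂(η : Measure (Curves d T)) = 0 := by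
  rw [← integral_mul_inner_sub_condExp (comap_tail_le t) (integrable_W₀ hT hη) hφ hφ1 e]
  refine integral_congr_ae ?_
  filter_upwards [hU, averageVelocity_ae_eq hT hη t] with γ h3 h4
  rw [h3, h4]

/-- After disintegration in time, the inner integral vanishes for almost every t ≤ s, because the
future after s is a function of the future after t and so is orthogonal to W₀ - V_t; for t > s the
factor χ(t) vanishes. -/
theorem IsDissipativeSolution.isBalanced (hT : 0 < T) {η : ProbabilityMeasure (Curves d T)}
    (h : IsDissipativeSolution η) : IsBalanced η := by
  obtain ⟨hη, V, hVm, hVa, hV⟩ := h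
  intro s χ g f e hs hχ hc hsupp hf hf1
  refine (integral_mul_inner_defect hT hη hVm hV (hf.comp (continuous_phase s g))
    (fun γ => hf1 _) hχ hc (hsupp.trans (Ioo_subset_Ioo_right hs.2.le)) e).trans ?_
  refine integral_eq_zero_of_ae ?_
  filter_upwards [hVa] with t ht
  by_cases hts : t ≤ s
  · rw [integral_mul_inner_W₀_sub_eq_zero hT hη
      (hf.measurable.comp (measurable_phase_comap_tail hts g)) (fun γ => hf1 _) ht e]
    simp
  · rw [image_eq_zero_of_notMem_tsupport fun hmem => hts (hsupp hmem).2.le]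
    simp

/-! ### A jointly measurable velocity determined by the future. -/

section RightDeriv

variable {E : Type*} [NormedAddCommGroup E] [NormedSpace ℝ E]

/-- The right derivative along the sequence of increments `1 / (n + 1)`. -/
def rightDeriv (f : ℝ → E) (t : ℝ) : E :=
  limUnder atTop fun n : ℕ => ((n : ℝ) + 1) • (f (t + 1 / ((n : ℝ) + 1)) - f t)

theorem HasDerivAt.rightDeriv_eq {f : ℝ → E} {f' : E} {t : ℝ} (h : HasDerivAt f f' t) :
    rightDeriv f t = f' := by
  refine Tendsto.limUnder_eq ?_
  have hu : Tendsto (fun n : ℕ => 1 / ((n : ℝ) + 1)) atTop (𝓝[≠] 0) :=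
    tendsto_nhdsWithin_iff.2 ⟨tendsto_one_div_add_atTop_nhds_zero_nat,
      Eventually.of_forall fun n => (by positivity : (0 : ℝ) < 1 / ((n : ℝ) + 1)).ne'⟩
  refine ((hasDerivAt_iff_tendsto_slope_zero.1 h).comp hu).congr fun n => ?_
  simp

/-- Only increments a ≥ 0 enter, so with u constant equal to t the σ-algebra may be the one
generated by the future after t. -/
theorem measurable_rightDeriv [CompleteSpace E] [MeasurableSpace E] [BorelSpace E]
    [SecondCountableTopology E]
    {Ω : Type*} {m : MeasurableSpace Ω} {f : Ω → ℝ → E} {u : Ω → ℝ}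
    (h : ∀ a : ℝ, 0 ≤ a → Measurable fun x => f x (u x + a)) :
    Measurable fun x => rightDeriv (f x) (u x) := by
  refine (StronglyMeasurable.limUnder fun n => ?_).measurable
  have h0 := h 0 le_rfl
  simp only [add_zero] at h0
  exact (((h _ (by positivity)).sub h0).const_smul ((n : ℝ) + 1)).stronglyMeasurable

/-- Differentiability with given derivative of a continuous function can be tested on rational
increments. -/
theorem hasDerivAt_iff_forall_rat {f : ℝ → E} {v : E} {t : ℝ} {U : Set ℝ} (hU : IsOpen U)
    (ht : t ∈ U) (hf : ContinuousOn f U) :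
    HasDerivAt f v t ↔ ∀ n : ℕ, ∃ m : ℕ, ∀ q : ℚ, |(q : ℝ)| < 1 / ((m : ℝ) + 1) →
      ‖f (t + q) - f t - (q : ℝ) • v‖ ≤ 1 / ((n : ℝ) + 1) * |(q : ℝ)| := by
  rw [hasDerivAt_iff_isLittleO_nhds_zero, Asymptotics.isLittleO_iff]
  constructor
  · intro h n
    obtain ⟨δ, hδ, hb⟩ := Metric.eventually_nhds_iff.1
      (h (show (0 : ℝ) < 1 / ((n : ℝ) + 1) by positivity))
    obtain ⟨m, hm⟩ := exists_nat_one_div_lt hδ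
    refine ⟨m, fun q hq => hb ?_⟩
    rw [dist_zero_right, Real.norm_eq_abs]
    exact hq.trans hm
  · intro h c hc
    obtain ⟨n, hn⟩ := exists_nat_one_div_lt hc
    obtain ⟨m, hm⟩ := h n
    have hpre : IsOpen ((fun x => t + x) ⁻¹' U) := hU.preimage (by fun_prop)
    let O : Set ℝ := ((fun x => t + x) ⁻¹' U) ∩ Metric.ball 0 (1 / ((m : ℝ) + 1))
    have hO : IsOpen O := hpre.inter Metric.isOpen_ball
    have h0 : (0 : ℝ) ∈ O := ⟨by simpa using ht, Metric.mem_ball_self (by positivity)⟩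
    filter_upwards [hO.mem_nhds h0] with x hx
    -- Both sides of the inequality are continuous in the increment near 0, so the bound passes from
    -- rational increments to their limits.
    have hcl : x ∈ closure (O ∩ range ((↑) : ℚ → ℝ)) :=
      Rat.denseRange_cast.open_subset_closure_inter hO hx
    have hfc : ContinuousOn (fun x => ‖f (t + x) - f t - x • v‖) O := by
      have h1 : ContinuousOn (fun x => f (t + x)) O :=
        hf.comp (by fun_prop) fun x hx => hx.1
      exact ((h1.sub continuousOn_const).sub (continuousOn_id.smul continuousOn_const)).norm
    refine ContinuousWithinAt.closure_le (g := fun x => c * ‖x‖) hcl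
      ((hfc x hx).mono inter_subset_left) (by fun_prop) ?_
    rintro _ ⟨hy, q, rfl⟩
    refine (hm q (mem_ball_zero_iff.1 hy.2)).trans ?_
    rw [Real.norm_eq_abs]
    gcongr

end RightDeriv

/-- A primitive of the curve depending at time `t` on the curve after time `t` only. -/
def futurePrimitive (γ : Curves d T) (t : ℝ) : Vec d :=
  -∫ τ in Ioo t T, γ.1 τ ∂(timeMeasure T)

theorem setIntegral_Ioo_timeMeasure_eq {E : Type*} [NormedAddCommGroup E] [NormedSpace ℝ E]
    {F : ℝ → E} (hF : Integrable F (timeMeasure T)) (t : ℝ) :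
    ∫ τ in Ioo t T, F τ ∂(timeMeasure T) =
      ((∫ τ, (Ioo (-1) T).indicator F τ) - ∫ τ in Iic 0, (Ioo (-1) T).indicator F τ) -
        ∫ τ in (0 : ℝ)..t, (Ioo (-1) T).indicator F τ := by
  have hi : Integrable ((Ioo (-1) T).indicator F) := (integrable_indicator_iff measurableSet_Ioo).2 hF
  have h1 : ∫ τ in Ioo t T, F τ ∂(timeMeasure T) = ∫ τ in Ioi t, (Ioo (-1) T).indicator F τ := by
    rw [setIntegral_indicator measurableSet_Ioo, Measure.restrict_restrict measurableSet_Ioo]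
    congr 2
    ext τ
    simp only [mem_inter_iff, mem_Ioo, mem_Ioi]
    tauto
  have h2 := intervalIntegral.integral_Iic_add_Ioi (b := t) hi.integrableOn hi.integrableOn
  have h3 := intervalIntegral.integral_Iic_sub_Iic (a := 0) (b := t) hi.integrableOn
    hi.integrableOn
  rw [h1, ← h2, ← h3]
  abel

theorem continuous_setIntegral_Ioo_timeMeasure {E : Type*} [NormedAddCommGroup E]
    [NormedSpace ℝ E] {F : ℝ → E} (hF : Integrable F (timeMeasure T)) :
    Continuous fun t => ∫ τ in Ioo t T, F τ ∂(timeMeasure T) := by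
  simp_rw [setIntegral_Ioo_timeMeasure_eq hF]
  exact continuous_const.sub (intervalIntegral.continuous_primitive (fun _ _ =>
    ((integrable_indicator_iff measurableSet_Ioo).2 hF).intervalIntegrable) 0)

theorem continuous_futurePrimitive (γ : Curves d T) : Continuous (futurePrimitive γ) :=
  (continuous_setIntegral_Ioo_timeMeasure (integrable_timeMeasure γ.1)).neg

theorem measurable_comap_futurePrimitive (t : ℝ) :
    Measurable[MeasurableSpace.comap (tail t : Curves d T → _) inferInstance]
      fun γ : Curves d T => futurePrimitive γ t := by
  have h1 : (fun γ : Curves d T => futurePrimitive γ t) =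
      (fun y : TailCurves d T t => -∫ τ, (1 : ℝ) • y τ ∂((timeMeasure T).restrict (Ioo t T))) ∘
        tail t := by
    ext1 γ
    simp only [one_smul, Function.comp_apply, futurePrimitive]
    congr 1
    refine integral_congr_ae ?_
    filter_upwards [LpToLpRestrictCLM_coeFn ℝ (Ioo t T) γ.1] with τ h
    rw [tail, h]
  rw [h1]
  exact (continuous_integral_smul (memLp_const 1)).neg.measurable.comp (comap_measurable _)

theorem measurable_futurePrimitive :
    Measurable fun p : ℝ × Curves d T => futurePrimitive p.2 p.1 :=
  measurable_uncurry_of_continuous_of_measurable (u := fun t (γ : Curves d T) =>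
    futurePrimitive γ t) continuous_futurePrimitive
    fun t => (measurable_comap_futurePrimitive t).mono (comap_tail_le t) le_rfl

/-- The right-continuous representative, as a function of the future of the curve. -/
def futureRep (γ : Curves d T) (t : ℝ) : Vec d := rightDeriv (futurePrimitive γ) t

/-- The velocity, as a jointly measurable function, and a function of the future of the curve. -/
def futureVelocity (p : ℝ × Curves d T) : Vec d := rightDeriv (futureRep p.2) p.1

theorem measurable_futureRep : Measurable fun p : ℝ × Curves d T => futureRep p.2 p.1 :=
  measurable_rightDeriv (f := fun p : ℝ × Curves d T => futurePrimitive p.2) (u := Prod.fst)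
    fun a _ => measurable_futurePrimitive.comp
    ((measurable_fst.add_const a).prodMk measurable_snd)

theorem measurable_futureVelocity : Measurable (futureVelocity : ℝ × Curves d T → Vec d) := by
  have h : ∀ a : ℝ, Measurable fun p : ℝ × Curves d T => futureRep p.2 (p.1 + a) := fun a =>
    measurable_futureRep.comp
      (f := fun p : ℝ × Curves d T => (p.1 + a, p.2)) (by fun_prop)
  exact measurable_rightDeriv (f := fun p : ℝ × Curves d T => futureRep p.2) (u := Prod.fst)
    fun a _ => h a

theorem comap_tail_anti {s t : ℝ} (hst : t ≤ s) :
    MeasurableSpace.comap (tail s : Curves d T → _) inferInstance ≤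
      MeasurableSpace.comap (tail t : Curves d T → _) inferInstance :=
  (measurable_comap_tail hst).comap_le

theorem measurable_comap_futureRep (t : ℝ) :
    Measurable[MeasurableSpace.comap (tail t : Curves d T → _) inferInstance]
      fun γ : Curves d T => futureRep γ t :=
  measurable_rightDeriv (f := fun γ : Curves d T => futurePrimitive γ) (u := fun _ => t)
    fun a ha => (measurable_comap_futurePrimitive (t + a)).mono
    (comap_tail_anti (by linarith)) le_rfl

/-- Two successive right derivatives of the primitive still use only times at or after t, and the
σ-algebras of the future decrease in time. -/
theorem measurable_comap_futureVelocity (t : ℝ) :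
    Measurable[MeasurableSpace.comap (tail t : Curves d T → _) inferInstance]
      fun γ : Curves d T => futureVelocity (t, γ) :=
  measurable_rightDeriv (f := fun γ : Curves d T => futureRep γ) (u := fun _ => t)
    fun a ha => (measurable_comap_futureRep (t + a)).mono
    (comap_tail_anti (by linarith)) le_rfl

theorem futureRep_eq_of_ae_eq {γ : Curves d T} {f : ℝ → Vec d} (hf : Continuous f)
    (h : γ.1 =ᵐ[timeMeasure T] f) {t : ℝ} (ht : t ∈ Ioo (-1) T) : futureRep γ t = f t := by
  refine HasDerivAt.rightDeriv_eq ?_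
  have he : futurePrimitive γ = fun t => -((∫ τ, (Ioo (-1) T).indicator f τ) -
      ∫ τ in Iic 0, (Ioo (-1) T).indicator f τ) + ∫ τ in (0 : ℝ)..t,
        (Ioo (-1) T).indicator f τ := by
    ext1 t
    rw [futurePrimitive, integral_congr_ae (ae_restrict_of_ae h),
      setIntegral_Ioo_timeMeasure_eq ((integrable_timeMeasure γ.1).congr h)]
    abel
  have hev : (Ioo (-1) T).indicator f =ᶠ[𝓝 t] f :=
    Filter.eventuallyEq_of_mem (isOpen_Ioo.mem_nhds ht) fun τ hτ => indicator_of_mem hτ f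
  have hi : Integrable ((Ioo (-1) T).indicator f) :=
    (integrable_indicator_iff measurableSet_Ioo).2
      ((integrable_timeMeasure γ.1).congr h)
  rw [he]
  have := intervalIntegral.integral_hasDerivAt_right (a := 0) (b := t) hi.intervalIntegrable
    (hi.aestronglyMeasurable.stronglyMeasurableAtFilter)
    (hf.continuousAt.congr hev.symm)
  rw [indicator_of_mem ht] at this
  exact this.const_add _

theorem IsWeakDeriv.futureRep_eqOn (hT : 0 < T) {γ : Curves d T}
    {v : Lp (Vec d) 2 (timeMeasure T)} (h : IsWeakDeriv γ.1 v) :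
    EqOn (futureRep γ) (contRep γ) (Ioo (-1) T) := fun t ht => by
  rw [h.contRep_eqOn hT ht]
  exact futureRep_eq_of_ae_eq (continuous_const.add (intervalIntegral_zeroExt_continuous v))
    (h.ae_eq hT) ht

theorem IsWeakDeriv.continuousOn_contRep (hT : 0 < T) {γ : Curves d T}
    {v : Lp (Vec d) 2 (timeMeasure T)} (h : IsWeakDeriv γ.1 v) :
    ContinuousOn (contRep γ) (Ioo (-1) T) :=
  (continuous_const.add (intervalIntegral_zeroExt_continuous v)).continuousOn.congr
    (h.contRep_eqOn hT)

/-- `velocity` involves a choice of representative, so the comparison goes through a measurable set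
S: differentiability with derivative `futureVelocity`, tested on rational increments. For almost
every curve, almost every time belongs to S by Lebesgue differentiation, and Fubini gives the claim
on the product. -/
theorem ae_velocity_eq_futureVelocity (hT : 0 < T) {η : ProbabilityMeasure (Curves d T)}
    (hη : η ∈ admissible d T) :
    ∀ᵐ p ∂((volume.restrict (Icc 0 T)).prod (η : Measure (Curves d T))),
      velocity p.2 p.1 = futureVelocity p := by
  let S : Set (ℝ × Curves d T) := ⋂ n : ℕ, ⋃ m : ℕ, ⋂ q : ℚ, {p | |(q : ℝ)| < 1 / ((m : ℝ) + 1) →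
    ‖futureRep p.2 (p.1 + q) - futureRep p.2 p.1 - (q : ℝ) • futureVelocity p‖ ≤
      1 / ((n : ℝ) + 1) * |(q : ℝ)|}
  have hS : MeasurableSet S := by
    refine MeasurableSet.iInter fun n => MeasurableSet.iUnion fun m => MeasurableSet.iInter
      fun q => MeasurableSet.imp (MeasurableSet.const _) (measurableSet_le ?_ measurable_const)
    exact (((measurable_futureRep.comp ((measurable_fst.add_const (q : ℝ)).prodMk
      measurable_snd)).sub measurable_futureRep).sub
        (measurable_futureVelocity.const_smul (q : ℝ))).norm
  have hiff : ∀ γ : Curves d T, energy γ ≠ ⊤ → ∀ t ∈ Ioo (-1) T,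
      (t, γ) ∈ S ↔ HasDerivAt (contRep γ) (futureVelocity (t, γ)) t := by
    intro γ hγ t ht
    obtain ⟨v, hv⟩ := exists_isWeakDeriv_of_energy_ne_top hγ
    have heq := hv.futureRep_eqOn hT
    have hc : ContinuousOn (futureRep γ) (Ioo (-1) T) := (hv.continuousOn_contRep hT).congr heq
    rw [← (Filter.eventuallyEq_of_mem (isOpen_Ioo.mem_nhds ht) heq).hasDerivAt_iff,
      hasDerivAt_iff_forall_rat isOpen_Ioo ht hc]
    simp only [S, mem_iInter, mem_iUnion, mem_ofPred_eq]
  have hSae : ∀ᵐ p ∂((volume.restrict (Icc 0 T)).prod (η : Measure (Curves d T))), p ∈ S := by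
    rw [ae_iff]
    change ((volume.restrict (Icc 0 T)).prod (η : Measure (Curves d T))) Sᶜ = 0
    rw [Measure.prod_apply_symm hS.compl, lintegral_eq_zero_iff
      (measurable_measure_prodMk_right hS.compl)]
    filter_upwards [ae_energy_ne_top hη] with γ hγ
    obtain ⟨v, hv⟩ := exists_isWeakDeriv_of_energy_ne_top hγ
    change (volume.restrict (Icc 0 T)) {t | ¬ (t, γ) ∈ S} = 0
    rw [← ae_iff]
    refine (restrict_Icc_le_timeMeasure T).absolutelyContinuous.ae_le ?_
    filter_upwards [hv.ae_hasDerivAt hT, ae_restrict_mem measurableSet_Ioo] with t h1 h2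
    rw [hiff γ hγ t h2]
    have h3 := h1.congr_of_eventuallyEq
      (Filter.eventuallyEq_of_mem (isOpen_Ioo.mem_nhds h2) (hv.futureRep_eqOn hT))
    have h4 : futureVelocity (t, γ) = v t := HasDerivAt.rightDeriv_eq h3
    rw [h4]
    exact h1
  have hI : ∀ᵐ t ∂(volume.restrict (Icc 0 T)), t ∈ Ioo (-1) T :=
    (restrict_Icc_le_timeMeasure T).absolutelyContinuous.ae_le (ae_restrict_mem measurableSet_Ioo)
  filter_upwards [hSae, Measure.quasiMeasurePreserving_fst.ae hI,
    Measure.quasiMeasurePreserving_snd.ae (ae_energy_ne_top hη)] with p h1 h2 h3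
  exact ((hiff p.2 h3 p.1 h2).1 h1).deriv

/-! ### Balanced measures are dissipative solutions. -/

/-- A function all of whose Fourier coefficients along a Hilbert space valued random variable
vanish has zero conditional expectation given that variable. -/
theorem setIntegral_preimage_eq_zero_of_fourier {Ω E : Type*} {m : MeasurableSpace Ω}
    {μ : Measure Ω} [NormedAddCommGroup E] [InnerProductSpace ℝ E] [CompleteSpace E]
    [MeasurableSpace E] [BorelSpace E] [SecondCountableTopology E] {X : Ω → E} (hX : Measurable X)
    {k : Ω → ℝ} (hk : Integrable k μ)
    (hcos : ∀ y, ∫ x, Real.cos (inner ℝ y (X x)) * k x ∂μ = 0)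
    (hsin : ∀ y, ∫ x, Real.sin (inner ℝ y (X x)) * k x ∂μ = 0)
    {A : Set E} (hA : MeasurableSet A) : ∫ x in X ⁻¹' A, k x ∂μ = 0 := by
  -- `ENNReal.ofReal` truncates at zero, so `ν k` and `ν (-k)` are the images under X of the
  -- positive and negative parts of k μ. The difference of their characteristic functions is the
  -- cosine integral plus i times the sine integral, so the two measures coincide.
  let ν : (Ω → ℝ) → Measure E := fun k => (μ.withDensity fun x => ENNReal.ofReal (k x)).map X
  have hfin : ∀ {k : Ω → ℝ}, Integrable k μ → IsFiniteMeasure (ν k) := fun {k} hk => by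
    have := isFiniteMeasure_withDensity_ofReal hk.2
    exact Measure.isFiniteMeasure_map _ _
  have := hfin hk
  have := hfin hk.neg
  have hexp : ∀ y : E, Continuous fun z : E => Complex.exp ((inner ℝ z y : ℝ) * Complex.I) :=
    fun y => by fun_prop
  have hchar : ∀ {k : Ω → ℝ}, Integrable k μ → ∀ y, charFun (ν k) y =
      ∫ x, max (k x) 0 • Complex.exp ((inner ℝ (X x) y : ℝ) * Complex.I) ∂μ := fun {k} hk y => by
    rw [charFun_apply, integral_map hX.aemeasurable (hexp y).aestronglyMeasurable,
      integral_withDensity_eq_integral_toReal_smul₀ hk.aemeasurable.ennreal_ofReal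
        (Eventually.of_forall fun x => ENNReal.ofReal_lt_top)]
    simp only [ENNReal.toReal_ofReal']
  have hexpi : ∀ {h : Ω → ℝ}, Integrable h μ → ∀ y : E,
      Integrable (fun x => h x • Complex.exp ((inner ℝ (X x) y : ℝ) * Complex.I)) μ :=
    fun {h} hh y => by
      refine hh.smul_bdd 1 ((hexp y).measurable.comp hX).aestronglyMeasurable
        (Eventually.of_forall fun x => ?_)
      rw [Complex.norm_exp_ofReal_mul_I]
  have heq : ν k = ν (-k) := by
    refine Measure.ext_of_charFun (funext fun y => ?_)
    rw [hchar hk, hchar hk.neg, ← sub_eq_zero, ← integral_sub (hexpi hk.pos_part y)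
      (hexpi hk.neg.pos_part y)]
    have h1 : ∀ x, max (k x) 0 • Complex.exp ((inner ℝ (X x) y : ℝ) * Complex.I) -
        max ((-k) x) 0 • Complex.exp ((inner ℝ (X x) y : ℝ) * Complex.I) =
        ((Real.cos (inner ℝ y (X x)) * k x : ℝ) : ℂ) +
          ((Real.sin (inner ℝ y (X x)) * k x : ℝ) : ℂ) * Complex.I := fun x => by
      rw [← sub_smul, Pi.neg_apply, max_zero_sub_max_neg_zero_eq_self, Complex.exp_mul_I,
        real_inner_comm]
      simp only [Complex.real_smul, Complex.ofReal_mul, Complex.ofReal_cos, Complex.ofReal_sin]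
      ring
    have hb : ∀ {f : ℝ → ℝ}, Continuous f → (∀ x, |f x| ≤ 1) →
        Integrable (fun x => ((f (inner ℝ y (X x)) * k x : ℝ) : ℂ)) μ := fun {f} hf hf1 =>
      (hk.bdd_mul ((hf.comp (continuous_const.inner continuous_id)).measurable.comp
        hX).aestronglyMeasurable (Eventually.of_forall fun x => hf1 _)).ofReal
    simp_rw [h1]
    rw [integral_add (hb Real.continuous_cos Real.abs_cos_le_one)
      ((hb Real.continuous_sin Real.abs_sin_le_one).mul_const _), integral_mul_const,
      integral_complex_ofReal, integral_complex_ofReal, hcos, hsin]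
    simp
  have hval := congrArg (fun ρ => ρ A) heq
  simp only [ν] at hval
  rw [Measure.map_apply hX hA, Measure.map_apply hX hA, withDensity_apply _ (hX hA),
    withDensity_apply _ (hX hA)] at hval
  rw [integral_eq_lintegral_pos_part_sub_lintegral_neg_part hk.integrableOn, hval]
  exact sub_self _

/-- For almost every time, balance against test functions of the future after a later time. -/
theorem IsBalanced.ae_integral_eq_zero (hT : 0 < T) {η : ProbabilityMeasure (Curves d T)}
    (hη : η ∈ admissible d T) (hb : IsBalanced η) {s : ℝ} (hs : s ∈ Ioo 0 T)
    (g : Lp (Vec d) 2 (timeMeasure T)) {f : ℝ → ℝ} (hf : Continuous f) (hf1 : ∀ x, |f x| ≤ 1)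
    (e : Vec d) :
    ∀ᵐ t, t ∈ Ioo 0 s → ∫ γ, f (phase s g γ) * inner ℝ (W₀ γ - futureVelocity (t, γ)) e
      ∂(η : Measure (Curves d T)) = 0 := by
  have hV := ae_velocity_eq_futureVelocity hT hη
  have hφ : Continuous fun γ : Curves d T => f (phase s g γ) := hf.comp (continuous_phase s g)
  have hint : IntegrableOn (fun t => ∫ γ, f (phase s g γ) *
      inner ℝ (W₀ γ - futureVelocity (t, γ)) e ∂(η : Measure (Curves d T))) (Icc 0 T) volume :=
    (integrable_inner_W₀_sub hT hη measurable_futureVelocity hV hφ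
      (fun γ => hf1 _) e).integral_prod_left
  have hsub : Ioo 0 s ⊆ Icc 0 T := fun t ht => ⟨ht.1.le, (ht.2.trans hs.2).le⟩
  refine isOpen_Ioo.ae_eq_zero_of_integral_contDiff_smul_eq_zero
    (hint.mono_set hsub).locallyIntegrableOn ?_
  intro χ hχ hc hsupp
  rw [← integral_smul_eq_of_tsupport_subset (hsupp.trans hsub)]
  simp only [smul_eq_mul]
  rw [← integral_mul_inner_defect hT hη measurable_futureVelocity hV hφ (fun γ => hf1 _) hχ hc
    (hsupp.trans (Ioo_subset_Ioo_right hs.2.le)) e]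
  exact hb s χ g f e hs hχ hc hsupp hf hf1

theorem continuous_phase_left (g : Lp (Vec d) 2 (timeMeasure T)) (γ : Curves d T) :
    Continuous fun s => phase s g γ :=
  continuous_setIntegral_Ioo_timeMeasure (L2.integrable_inner g γ.1)

theorem continuous_phase_mid (s : ℝ) (γ : Curves d T) :
    Continuous fun g : Lp (Vec d) 2 (timeMeasure T) => phase s g γ := by
  simp_rw [phase_eq_inner]
  exact (ContinuousLinearMap.continuous _).inner continuous_const

/-- The exceptional times of the balance condition depend on s and g, so only countably many pairs
can be handled at once. The remaining ones follow by dominated convergence: rational q decreases to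
t, then g is approximated from a dense sequence. -/
theorem integral_phase_eq_zero_of_rat {μ : Measure (Curves d T)} {k : Curves d T → ℝ}
    (hk : Integrable k μ) {t : ℝ} (ht : t < T) {f : ℝ → ℝ} (hf : Continuous f)
    (hf1 : ∀ x, |f x| ≤ 1) {D : ℕ → Lp (Vec d) 2 (timeMeasure T)} (hD : DenseRange D)
    (h : ∀ (q : ℚ) (n : ℕ), t < q → (q : ℝ) < T → ∫ γ, f (phase q (D n) γ) * k γ ∂μ = 0)
    (g : Lp (Vec d) 2 (timeMeasure T)) : ∫ γ, f (phase t g γ) * k γ ∂μ = 0 := by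
  have hmeas : ∀ s g, AEStronglyMeasurable (fun γ : Curves d T => f (phase s g γ) * k γ) μ :=
    fun s g => (hf.comp (continuous_phase s g)).aestronglyMeasurable.mul hk.aestronglyMeasurable
  have hbd : ∀ s g, ∀ᵐ γ ∂μ, ‖f (phase s g γ) * k γ‖ ≤ ‖k γ‖ := fun s g =>
    Eventually.of_forall fun γ => by
      rw [norm_mul]
      exact mul_le_of_le_one_left (norm_nonneg _) (hf1 _)
  have h1 : ∀ n, ∫ γ, f (phase t (D n) γ) * k γ ∂μ = 0 := fun n => by
    obtain ⟨u, -, hu, hut⟩ := Real.exists_seq_rat_strictAnti_tendsto t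
    have hlim : Tendsto (fun i => ∫ γ, f (phase (u i) (D n) γ) * k γ ∂μ) atTop
        (𝓝 (∫ γ, f (phase t (D n) γ) * k γ ∂μ)) :=
      tendsto_integral_of_dominated_convergence _ (fun i => hmeas _ _) hk.norm (fun i => hbd _ _)
        (Eventually.of_forall fun γ => ((hf.tendsto _).comp
          (((continuous_phase_left (D n) γ).tendsto t).comp hut)).mul_const _)
    refine tendsto_nhds_unique hlim (tendsto_const_nhds.congr' ?_)
    filter_upwards [hut.eventually_lt_const ht] with i hi
    exact (h (u i) n (hu i) hi).symm
  have hcont : Continuous fun g => ∫ γ, f (phase t g γ) * k γ ∂μ :=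
    continuous_of_dominated (fun g => hmeas t g) (fun g => hbd t g) hk.norm
      (Eventually.of_forall fun γ => (hf.comp (continuous_phase_mid t γ)).mul continuous_const)
  exact congrFun (hD.equalizer hcont continuous_const (funext h1)) g

theorem exists_restrict_eq (t : ℝ) (y : TailCurves d T t) :
    ∃ g, LpToLpRestrictCLM ℝ (Vec d) ℝ (timeMeasure T) 2 (Ioo t T) g = y := by
  have hm : MemLp ((Ioo t T).indicator y) 2 (timeMeasure T) :=
    (memLp_indicator_iff_restrict measurableSet_Ioo).2 (Lp.memLp y)
  refine ⟨hm.toLp _, Lp.ext ?_⟩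
  filter_upwards [LpToLpRestrictCLM_coeFn ℝ (Ioo t T) (hm.toLp _),
    ae_restrict_of_ae hm.coeFn_toLp, ae_restrict_mem measurableSet_Ioo] with τ h1 h2 h3
  rw [h1, h2, indicator_of_mem h3]

/-- By Riesz every linear functional of T_t(γ) is a phase, so Fourier uniqueness, applied to each
coordinate, gives W₀ - U zero integral over every event of the future. As U is a function of the
future, this characterises it as the conditional expectation of W₀. -/
theorem eq_averageVelocity_of_integral_phase (hT : 0 < T) {η : ProbabilityMeasure (Curves d T)}
    (hη : η ∈ admissible d T) {t : ℝ} {U : Curves d T → Vec d}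
    (hUm : Measurable[MeasurableSpace.comap (tail t) inferInstance] U)
    (hU : Integrable U (η : Measure (Curves d T)))
    (hcos : ∀ g (j : Fin d), ∫ γ, Real.cos (phase t g γ) *
      inner ℝ (W₀ γ - U γ) (EuclideanSpace.single j (1 : ℝ)) ∂(η : Measure (Curves d T)) = 0)
    (hsin : ∀ g (j : Fin d), ∫ γ, Real.sin (phase t g γ) *
      inner ℝ (W₀ γ - U γ) (EuclideanSpace.single j (1 : ℝ)) ∂(η : Measure (Curves d T)) = 0) :
    ∀ᵐ γ ∂(η : Measure (Curves d T)), U γ = averageVelocity η t γ := by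
  have : Fact ((2 : ℝ≥0∞) ≠ ⊤) := ⟨ENNReal.ofNat_ne_top⟩
  have hW := integrable_W₀ hT hη
  have hWU : Integrable (fun γ => W₀ γ - U γ) (η : Measure (Curves d T)) := hW.sub hU
  refine EventuallyEq.trans ?_ (averageVelocity_ae_eq hT hη t)
  refine ae_eq_condExp_of_forall_setIntegral_eq (comap_tail_le t) hW
    (fun _ _ _ => hU.integrableOn) ?_ hUm.stronglyMeasurable.aestronglyMeasurable
  rintro _ ⟨A, hA, rfl⟩ -
  rw [eq_comm, ← sub_eq_zero, ← integral_sub hW.integrableOn hU.integrableOn]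
  ext j
  have hsel : ∀ y : TailCurves d T t, ∃ g, ∀ γ : Curves d T, inner ℝ y (tail t γ) = phase t g γ :=
    fun y => by
      obtain ⟨g, rfl⟩ := exists_restrict_eq t y
      exact ⟨g, fun γ => (phase_eq_inner t g γ).symm⟩
  have key := setIntegral_preimage_eq_zero_of_fourier (continuous_tail t).measurable
    (hWU.inner_const (EuclideanSpace.single j (1 : ℝ)))
    (fun y => by
      obtain ⟨g, hg⟩ := hsel y
      simp_rw [hg]
      exact hcos g j)
    (fun y => by
      obtain ⟨g, hg⟩ := hsel y
      simp_rw [hg]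
      exact hsin g j) hA
  simp_rw [real_inner_comm (EuclideanSpace.single j (1 : ℝ))] at key
  rw [integral_inner hWU.integrableOn] at key
  simpa [EuclideanSpace.inner_single_left] using key

theorem IsBalanced.isDissipativeSolution (hT : 0 < T) {η : ProbabilityMeasure (Curves d T)}
    (hη : η ∈ admissible d T) (hb : IsBalanced η) : IsDissipativeSolution η := by
  have : Fact ((2 : ℝ≥0∞) ≠ ⊤) := ⟨ENNReal.ofNat_ne_top⟩
  have hV := ae_velocity_eq_futureVelocity hT hη
  refine ⟨hη, futureVelocity, measurable_futureVelocity, ?_, hV⟩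
  let D : ℕ → Lp (Vec d) 2 (timeMeasure T) := TopologicalSpace.denseSeq _
  have hD : DenseRange D := TopologicalSpace.denseRange_denseSeq _
  -- Countably many (q, n, j), hence one null set of times for all of them.
  have hall : ∀ {f : ℝ → ℝ}, Continuous f → (∀ x, |f x| ≤ 1) → ∀ᵐ t, ∀ (q : ℚ) (n : ℕ)
      (j : Fin d), (q : ℝ) ∈ Ioo 0 T → t ∈ Ioo 0 (q : ℝ) → ∫ γ, f (phase q (D n) γ) *
        inner ℝ (W₀ γ - futureVelocity (t, γ)) (EuclideanSpace.single j (1 : ℝ))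
          ∂(η : Measure (Curves d T)) = 0 := fun {f} hf hf1 => by
    simp only [ae_all_iff]
    exact fun q n j hq => hb.ae_integral_eq_zero hT hη hq (D n) hf hf1 _
  have h0 : ∀ᵐ t ∂(volume.restrict (Icc 0 T)), t ∈ Ioo 0 T := by
    rw [← Measure.restrict_congr_set (Ioo_ae_eq_Icc (μ := volume) (a := (0 : ℝ)) (b := T))]
    exact ae_restrict_mem measurableSet_Ioo
  filter_upwards [ae_restrict_of_ae (hall Real.continuous_cos Real.abs_cos_le_one),
    ae_restrict_of_ae (hall Real.continuous_sin Real.abs_sin_le_one), h0,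
    (integrable_velocity hT hη measurable_futureVelocity hV).prod_right_ae]
    with t h1 h2 ht hint
  have hk : ∀ j : Fin d, Integrable (fun γ => inner ℝ (W₀ γ - futureVelocity (t, γ))
      (EuclideanSpace.single j (1 : ℝ))) (η : Measure (Curves d T)) := fun j =>
    ((integrable_W₀ hT hη).sub hint).inner_const _
  refine eq_averageVelocity_of_integral_phase hT hη (measurable_comap_futureVelocity t) hint
    (fun g j => ?_) (fun g j => ?_)
  · exact integral_phase_eq_zero_of_rat (hk j) ht.2 Real.continuous_cos Real.abs_cos_le_one hD
      (fun q n hq hqT => h1 q n j ⟨ht.1.trans hq, hqT⟩ ⟨ht.1, hq⟩) g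
  · exact integral_phase_eq_zero_of_rat (hk j) ht.2 Real.continuous_sin Real.abs_sin_le_one hD
      (fun q n hq hqT => h2 q n j ⟨ht.1.trans hq, hqT⟩ ⟨ht.1, hq⟩) g

end PressurelessEuler

end

/-- The set of dissipative solutions is compact in the narrow topology of `P(Γ)`. -/
theorem mainTheorem2 (d : ℕ) (T : ℝ) (hT : 0 < T) :
    IsCompact {η : ProbabilityMeasure (PressurelessEuler.Curves d T) |
      PressurelessEuler.IsDissipativeSolution η} := by
  convert PressurelessEuler.isCompact_setOf_isBalanced (d := d) hT using 1
  ext η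
  exact ⟨fun h => ⟨h.1, h.isBalanced hT⟩, fun h => h.2.isDissipativeSolution hT h.1⟩
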